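/- Let $S^d=\{x\in\mathbb R^{d+1}:\|x\|=1\}$ with surface measure $d\omega$. For $\tau\in\mathbb R^{d+1}$ with all $\tau_i>-\tfrac12$ put $h_\tau(x)=\prod_{i=1}^{d+1}|x_i|^{\tau_i}$ and, for $0<p<\infty$, $\|F\|_{\tau,p}=\big(\int_{S^d}|F|^p\,h_\tau^2\,d\omega\big)^{1/p}\in[0,\infty]$. Let $\kappa\in\mathbb R^{d+1}$ with all $\kappa_i\ge 0$, and let $$V_\kappa g(y)=c_\kappa\int_{[-1,1]^{d+1}}g(y_1t_1,\dots,y_{d+1}t_{d+1})\prod_{i=1}^{d+1}(1+t_i)(1-t_i^2)^{\kappa_i-1}\,dt,$$ where $c_\kappa$ is determined by $V_\kappa 1=1$; if some $\kappa_i=0$, the normalized measure in the variable $t_i$ is replaced by its weak limit as $\kappa_i\to0^+$, the unit point mass at $t_i=1$. For $x\in S^d$ let $B(x,\theta)=\{z\in\mathbb R^{d+1}:\|z\|\le1,\ \langle x,z\rangle\ge\cos\theta\}$, and for measurable $f$ on $S^d$ define $$\mathcal M_\kappa f(x)=\sup_{0<\theta\le\pi}\frac{\int_{S^d}|f(y)|\,V_\kappa[\chi_{B(x,\theta)}](y)\,h_\kappa^2(y)\,d\omega(y)}{\int_{S^d}V_\kappa[\chi_{B(x,\theta)}](y)\,h_\kappa^2(y)\,d\omega(y)}\in[0,\infty].$$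 **Theorem.** Let $1<p<\infty$ and let $-\tfrac12<\tau_i<p\kappa_i+\tfrac{p-1}2$ for all $1\le i\le d+1$. Then there is a constant $c<\infty$, depending only on $d,\kappa,\tau,p$, such that for every sequence $\{f_j\}_{j=1}^\infty$ of measurable (real- or complex-valued) functions on $S^d$, $$\Big\|\Big(\sum_{j=1}^\infty(\mathcal M_\kappa f_j)^2\Big)^{1/2}\Big\|_{\tau,p}\le c\,\Big\|\Big(\sum_{j=1}^\infty|f_j|^2\Big)^{1/2}\Big\|_{\tau,p}.$$ -/

import Mathlib

open MeasureTheory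
open scoped ENNReal NNReal

noncomputable section

/-- The unit sphere `S^d` in the Euclidean space `ℝ^(d+1)`. -/
abbrev UnitSphere (d : ℕ) : Type :=
  Metric.sphere (0 : EuclideanSpace ℝ (Fin (d + 1))) 1

/-- The surface (Lebesgue) measure `dω` on `S^d`. -/
def surfaceMeasure (d : ℕ) : Measure (UnitSphere d) :=
  (volume : Measure (EuclideanSpace ℝ (Fin (d + 1)))).toSphere

/-- The product weight `h_τ(x) = ∏ i, |x_i| ^ τ_i`. -/
def productWeight {d : ℕ} (τ : Fin (d + 1) → ℝ) (x : EuclideanSpace ℝ (Fin (d + 1))) : ℝ :=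
  ∏ i, |x i| ^ τ i

/-- The measure `h_τ² dω` on `S^d`. -/
def weightedMeasure {d : ℕ} (τ : Fin (d + 1) → ℝ) : Measure (UnitSphere d) :=
  (surfaceMeasure d).withDensity fun x => ENNReal.ofReal (productWeight τ x ^ 2)

/-- The quantity `‖F‖_{τ,p} = (∫ F^p h_τ² dω)^(1/p)` of a function with values in `[0,∞]`. -/
def weightedNorm {d : ℕ} (τ : Fin (d + 1) → ℝ) (p : ℝ) (F : UnitSphere d → ℝ≥0∞) : ℝ≥0∞ :=
  (∫⁻ x, F x ^ p ∂(weightedMeasure τ)) ^ (1 / p)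

/-- The measure `(1 + t) (1 - t²)^(k-1) dt` on `[-1,1]`. -/
def intertwiningDensityMeasure (k : ℝ) : Measure ℝ :=
  (volume.restrict (Set.Icc (-1) 1)).withDensity fun t =>
    ENNReal.ofReal ((1 + t) * (1 - t ^ 2) ^ (k - 1))

open Classical in
/-- One coordinate of the measure representing the intertwining operator: for `k > 0` it is
`(1 + t) (1 - t²)^(k-1) dt` on `[-1,1]`, normalized to total mass one; for `k = 0` it is the weak
limit of these measures as `k → 0⁺`, the unit point mass at `1`. -/
def intertwiningMeasure (k : ℝ) : Measure ℝ :=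
  if k = 0 then Measure.dirac 1
  else (intertwiningDensityMeasure k Set.univ)⁻¹ • intertwiningDensityMeasure k

/-- The intertwining operator `V_κ` of the group `ℤ₂^(d+1)`, on functions with values in `[0,∞]`:
`V_κ g(y) = c_κ ∫ g(y_1 t_1, …, y_{d+1} t_{d+1}) ∏ i, (1 + t_i) (1 - t_i²)^(κ_i - 1) dt`. -/
def intertwiningOp {d : ℕ} (κ : Fin (d + 1) → ℝ)
    (g : EuclideanSpace ℝ (Fin (d + 1)) → ℝ≥0∞) (y : EuclideanSpace ℝ (Fin (d + 1))) : ℝ≥0∞ :=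
  ∫⁻ t : Fin (d + 1) → ℝ, g (WithLp.toLp 2 fun i => y i * t i)
    ∂(Measure.pi fun i => intertwiningMeasure (κ i))

/-- The solid cap `B(x,θ) = {z : ‖z‖ ≤ 1, ⟨x,z⟩ ≥ cos θ}`. -/
def solidCap {d : ℕ} (x : EuclideanSpace ℝ (Fin (d + 1))) (θ : ℝ) :
    Set (EuclideanSpace ℝ (Fin (d + 1))) :=
  {z | ‖z‖ ≤ 1 ∧ Real.cos θ ≤ inner ℝ x z}

/-- The maximal function `𝓜_κ f(x)`: the supremum over `0 < θ ≤ π` of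
`(∫ |f| V_κ[χ_{B(x,θ)}] h_κ² dω) / (∫ V_κ[χ_{B(x,θ)}] h_κ² dω)`, with values in `[0,∞]`. -/
def intertwiningMaximal {d : ℕ} {𝕜 : Type*} [RCLike 𝕜] (κ : Fin (d + 1) → ℝ)
    (f : UnitSphere d → 𝕜) (x : UnitSphere d) : ℝ≥0∞ :=
  ⨆ θ ∈ Set.Ioc 0 Real.pi,
    (∫⁻ y, ‖f y‖ₑ * intertwiningOp κ ((solidCap x.1 θ).indicator 1) y.1 ∂(weightedMeasure κ)) /
      ∫⁻ y, intertwiningOp κ ((solidCap x.1 θ).indicator 1) y.1 ∂(weightedMeasure κ)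

end

noncomputable section

open Set Metric

/-! The kernel `V_κ[χ_{B(x,θ)}](y)` spreads over all orthants, so it is natural to forget signs: on
the sphere use the pseudo-metric `max_i ||x_i| - |y_i||`. The cap condition `⟨x, (y_i t_i)⟩ ≥ cos θ`
then decouples. It forces `||x_i| - |y_i|| ≤ θ` and puts each `t_i` near the sign of `x_i y_i`,
which costs a factor of order `(θ/(|x_i|+θ))^(2κ_i)`. Hence the kernel is at most a multiple of
`kernelSize` on the folded ball of radius `2θ`, vanishes outside it, and is at least a multiple of
`kernelSize` on a small ball inside the orthant of `x`. That one-orthant ball carries a fixed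
proportion of the mass of the folded ball, so `intertwiningMaximal` is dominated pointwise by the
Hardy–Littlewood maximal function of `h_κ² dω` (`FoldedSphere.intertwiningMaximal_le`).

What remains is a weighted vector-valued inequality with explicit power weights. Balls have
`h_τ²`-measure comparable to `r^d ∏ (|x_i|+r)^(2τ_i)` (`measure_ball_le`, `le_measure_signedBall`),
which gives doubling and, by multiplying powers, the Muckenhoupt condition. Hölder on each ball
yields `M_κ g ≤ K (M_τ g^r)^(1/r)` (`maximalFn_le_rpow`). The admissible range of `τ` is open in the
exponent, so `r` may be taken slightly below the target exponent, and boundedness follows from that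
of `M_τ` on its own space (`maximalFn_strong_type`); no reverse Hölder inequality is needed.

For sequences, the inequality `∫ (Mf)^q v ≤ C ∫ f^q Mv` (`IsDoublingOn.fefferman_stein`) is dualized
in `L^(p/q)`: the maximal operator moves from all the `f_j` to one test function, where boundedness
on the dual weighted space applies. The dual weight is admissible once `q > 1` is close to `1`, so
this gives the `ℓ^q` inequality for such a `q`. The `ℓ^2` inequality follows by factoring `f_j =
g_j^a F^(1-a)`, with `F` the `ℓ^2` norm of the sequence, and using Hölder on averages
(`maximalFn_vector_valued_mono`). -/

/-- The uncentred Hardy–Littlewood maximal function of a function with values in `[0,∞]`: the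
supremum of its averages over the open balls containing the point. -/
def maximalFn {X : Type*} [PseudoMetricSpace X] [MeasurableSpace X] (μ : Measure X)
    (f : X → ℝ≥0∞) (x : X) : ℝ≥0∞ :=
  ⨆ (z : X) (r : ℝ) (_ : x ∈ ball z r), (∫⁻ y in ball z r, f y ∂μ) / μ (ball z r)

/-- A doubling measure on a bounded space, all of whose balls have positive finite measure. -/
structure IsDoublingOn {X : Type*} [PseudoMetricSpace X] [MeasurableSpace X] (μ : Measure X)
    (D : ℝ≥0) : Prop where
  ball_pos : ∀ (x : X) (r : ℝ), 0 < r → 0 < μ (ball x r)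
  ball_lt_top : ∀ (x : X) (r : ℝ), μ (ball x r) < ∞
  doubling : ∀ (x : X) (r : ℝ), 0 < r → μ (ball x (4 * r)) ≤ D * μ (ball x r)

/-! ### Layer-cake integrals. -/

section LayerCake

lemma lintegral_Ioo_rpow {x q : ℝ} (hx : 0 ≤ x) (hq : 0 < q) :
    ∫⁻ t in Ioo 0 x, ENNReal.ofReal (t ^ (q - 1)) = ENNReal.ofReal (x ^ q / q) := by
  have hint : IntervalIntegrable (fun t : ℝ => t ^ (q - 1)) volume 0 x :=
    intervalIntegral.intervalIntegrable_rpow' (by linarith)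
  rw [Measure.restrict_congr_set Ioo_ae_eq_Ioc, ← ofReal_integral_eq_lintegral_ofReal hint.1,
    ← intervalIntegral.integral_of_le hx, integral_rpow (Or.inl (by linarith))]
  · simp [Real.zero_rpow hq.ne']
  · filter_upwards [ae_restrict_mem measurableSet_Ioc] with t ht
    exact Real.rpow_nonneg ht.1.le _

lemma lintegral_indicator_lt_rpow (a : ℝ≥0∞) {q : ℝ} (hq : 0 < q) :
    ∫⁻ t in Ioi (0 : ℝ), {t : ℝ | ENNReal.ofReal t < a}.indicator
      (fun t => ENNReal.ofReal (t ^ (q - 1))) t = a ^ q / ENNReal.ofReal q := by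
  have hfin : ∀ x : ℝ≥0, ∫⁻ t in Ioi (0 : ℝ), {t : ℝ | ENNReal.ofReal t < x}.indicator
      (fun t => ENNReal.ofReal (t ^ (q - 1))) t = (x : ℝ≥0∞) ^ q / ENNReal.ofReal q := by
    intro x
    have hms : MeasurableSet {t : ℝ | ENNReal.ofReal t < x} :=
      measurableSet_lt (by fun_prop) (by fun_prop)
    rw [lintegral_indicator hms, Measure.restrict_restrict hms]
    have : {t : ℝ | ENNReal.ofReal t < x} ∩ Ioi 0 = Ioo 0 (x : ℝ) := by
      ext t
      simp only [mem_inter_iff, mem_ofPred_eq, mem_Ioi, mem_Ioo]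
      rw [and_comm]
      refine and_congr_right fun ht => ?_
      rw [← ENNReal.ofReal_coe_nnreal, ENNReal.ofReal_lt_ofReal_iff_of_nonneg ht.le]
    rw [this, lintegral_Ioo_rpow x.coe_nonneg hq, ENNReal.ofReal_div_of_pos hq,
      ← ENNReal.ofReal_rpow_of_nonneg x.coe_nonneg hq.le, ENNReal.ofReal_coe_nnreal]
  induction a using ENNReal.recTopCoe with
  | coe x => exact hfin x
  | top =>
    rw [ENNReal.top_rpow_of_pos hq, ENNReal.top_div_of_ne_top ENNReal.ofReal_ne_top]
    refine ENNReal.eq_top_of_forall_nnreal_le fun y => ?_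
    -- The finite level `(y q)^(1/q)` has integral exactly `y`, so the integral at level `∞` exceeds
    -- every `y`.
    have h := hfin ((y * q.toNNReal) ^ q⁻¹)
    rw [ENNReal.coe_rpow_of_nonneg _ (inv_nonneg.2 hq.le), ENNReal.rpow_inv_rpow hq.ne',
      ENNReal.coe_mul] at h
    have h2 : (y : ℝ≥0∞) * (q.toNNReal : ℝ≥0∞) / ENNReal.ofReal q = y := by
      apply ENNReal.mul_div_cancel_right
      · simpa using hq
      · exact ENNReal.ofReal_ne_top
    rw [h2] at h
    rw [← h]
    refine lintegral_mono fun t => indicator_le_indicator_of_subset ?_ (fun _ => zero_le) t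
    intro t ht
    exact ENNReal.ofReal_lt_top

end LayerCake

/-! ### The maximal function of a doubling measure: weighted weak and strong type. -/

section Maximal

variable {X : Type*} [PseudoMetricSpace X] [MeasurableSpace X]
  {μ : Measure X} {D : ℝ≥0}

lemma le_maximalFn {f : X → ℝ≥0∞} {x z : X} {r : ℝ} (h : x ∈ ball z r) :
    (∫⁻ y in ball z r, f y ∂μ) / μ (ball z r) ≤ maximalFn μ f x :=
  le_iSup_of_le z <| le_iSup_of_le r <| le_iSup_of_le h le_rfl

lemma maximalFn_le {f : X → ℝ≥0∞} {x : X} {a : ℝ≥0∞}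
    (h : ∀ z r, x ∈ ball z r → (∫⁻ y in ball z r, f y ∂μ) / μ (ball z r) ≤ a) :
    maximalFn μ f x ≤ a :=
  iSup_le fun z => iSup_le fun r => iSup_le fun hx => h z r hx

lemma lt_maximalFn_iff {f : X → ℝ≥0∞} {x : X} {a : ℝ≥0∞} :
    a < maximalFn μ f x ↔
      ∃ z r, x ∈ ball z r ∧ a < (∫⁻ y in ball z r, f y ∂μ) / μ (ball z r) := by
  simp [maximalFn, lt_iSup_iff]

/-- Because the maximal function is uncentred, a superlevel set is the union of the balls whose
average exceeds the level; this is the source of measurability. -/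
lemma isOpen_lt_maximalFn (f : X → ℝ≥0∞) (a : ℝ≥0∞) : IsOpen {x | a < maximalFn μ f x} := by
  have : {x | a < maximalFn μ f x} =
      ⋃ (z : X) (r : ℝ) (_ : a < (∫⁻ y in ball z r, f y ∂μ) / μ (ball z r)), ball z r := by
    ext x
    simp only [mem_ofPred_eq, lt_maximalFn_iff, mem_iUnion, exists_prop]
    exact exists_congr fun z => exists_congr fun r => and_comm
  rw [this]
  exact isOpen_iUnion fun z => isOpen_iUnion fun r => isOpen_iUnion fun _ => isOpen_ball

lemma measurable_maximalFn [OpensMeasurableSpace X] (f : X → ℝ≥0∞) :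
    Measurable (maximalFn μ f) :=
  measurable_of_Ioi fun a => (isOpen_lt_maximalFn f a).measurableSet

lemma maximalFn_mono_ae {f g : X → ℝ≥0∞} (h : ∀ᵐ y ∂μ, f y ≤ g y) (x : X) :
    maximalFn μ f x ≤ maximalFn μ g x :=
  maximalFn_le fun _ _ hx => le_trans
    (ENNReal.div_le_div_right (lintegral_mono_ae (ae_restrict_of_ae h)) _) (le_maximalFn hx)

lemma mul_div_self_le_ennreal (a b : ℝ≥0∞) : a * b / b ≤ a :=
  ENNReal.div_le_of_le_mul le_rfl

lemma maximalFn_const_le (a : ℝ≥0∞) (x : X) : maximalFn μ (fun _ => a) x ≤ a := by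
  refine maximalFn_le fun z r _ => ?_
  rw [setLIntegral_const]
  exact mul_div_self_le_ennreal _ _

lemma maximalFn_zero (x : X) : maximalFn μ (fun _ => 0) x = 0 :=
  le_antisymm (maximalFn_const_le 0 x) zero_le

lemma maximalFn_add_const_le {f : X → ℝ≥0∞} (hf : Measurable f) (a : ℝ≥0∞) (x : X) :
    maximalFn μ (fun y => f y + a) x ≤ maximalFn μ f x + a := by
  refine maximalFn_le fun z r hx => ?_
  rw [lintegral_add_left hf, ENNReal.add_div, setLIntegral_const]
  exact add_le_add (le_maximalFn hx) (mul_div_self_le_ennreal _ _)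

/-- Vitali's covering lemma with a weight: the average of `v` over an enlarged ball is a lower bound
for `maximalFn μ v` throughout the original ball, so the weight can be carried inside the integral
over the disjoint balls. -/
lemma IsDoublingOn.weak_type [OpensMeasurableSpace X] [SecondCountableTopology X]
    [BoundedSpace X] (hμ : IsDoublingOn μ D) (f v : X → ℝ≥0∞) {t : ℝ≥0∞} (ht0 : t ≠ 0)
    (ht : t ≠ ∞) :
    ∫⁻ x in {x | t < maximalFn μ f x}, v x ∂μ ≤ D / t * ∫⁻ x, f x * maximalFn μ v x ∂μ := by
  obtain ⟨R, hR⟩ := Metric.isBounded_iff.1 (BoundedSpace.bounded_univ (α := X))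
  replace hR : ∀ x y : X, dist x y ≤ R := fun x y => hR (mem_univ x) (mem_univ y)
  -- Vitali's lemma needs bounded radii; in a bounded space, cutting radii at `R + 1` changes no
  -- ball.
  have hball : ∀ (z : X) (r : ℝ), ball z (min r (R + 1)) = ball z r := by
    intro z r
    refine Subset.antisymm (ball_subset_ball (min_le_left _ _)) fun y hy => ?_
    exact lt_min hy (lt_of_le_of_lt (hR y z) (by linarith))
  let S : Set (X × ℝ) := {a | 0 < a.2 ∧ a.2 ≤ R + 1 ∧
    t < (∫⁻ y in ball a.1 a.2, f y ∂μ) / μ (ball a.1 a.2)}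
  -- The enlargement factor must exceed `3`; the value `4` is the one in `IsDoublingOn.doubling`.
  obtain ⟨u, huS, hdisj, hcov⟩ := Vitali.exists_disjoint_subfamily_covering_enlargement_ball
    S Prod.fst Prod.snd (R + 1) (fun a ha => ha.2.1) 4 (by norm_num)
  have hucount : u.Countable := hdisj.countable_of_isOpen (fun a _ => isOpen_ball)
    (fun a ha => ⟨a.1, mem_ball_self (huS ha).1⟩)
  have hsub : {x | t < maximalFn μ f x} ⊆ ⋃ b ∈ u, ball b.1 (4 * b.2) := by
    intro x hx
    obtain ⟨z, r, hxr, hlt⟩ := lt_maximalFn_iff.1 hx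
    have hmem : (z, min r (R + 1)) ∈ S := by
      refine ⟨?_, min_le_right _ _, ?_⟩
      · refine lt_min (pos_of_mem_ball hxr) ?_
        linarith [dist_nonneg.trans (hR z z)]
      · simpa only [hball] using hlt
    obtain ⟨b, hb, hsub⟩ := hcov _ hmem
    refine mem_iUnion₂.2 ⟨b, hb, hsub ?_⟩
    simpa only [hball] using hxr
  have hone : ∀ b ∈ u, ∫⁻ x in ball b.1 (4 * b.2), v x ∂μ ≤
      D / t * ∫⁻ x in ball b.1 b.2, f x * maximalFn μ v x ∂μ := by
    intro b hb
    obtain ⟨hb0, -, hbt⟩ := huS hb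
    have h4 : 0 < 4 * b.2 := by linarith
    set A := (∫⁻ x in ball b.1 (4 * b.2), v x ∂μ) / μ (ball b.1 (4 * b.2)) with hA
    have hμB : μ (ball b.1 b.2) ≤ (∫⁻ y in ball b.1 b.2, f y ∂μ) / t := by
      rw [ENNReal.le_div_iff_mul_le (Or.inl ht0) (Or.inl ht), mul_comm]
      exact (ENNReal.le_div_iff_mul_le (Or.inl (hμ.ball_pos _ _ hb0).ne')
        (Or.inl (hμ.ball_lt_top _ _).ne)).1 hbt.le
    calc ∫⁻ x in ball b.1 (4 * b.2), v x ∂μ = A * μ (ball b.1 (4 * b.2)) :=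
          (ENNReal.div_mul_cancel (hμ.ball_pos _ _ h4).ne' (hμ.ball_lt_top _ _).ne).symm
      _ ≤ A * (D * ((∫⁻ y in ball b.1 b.2, f y ∂μ) / t)) := by
          gcongr
          exact (hμ.doubling _ _ hb0).trans (by gcongr)
      _ = D / t * ((∫⁻ y in ball b.1 b.2, f y ∂μ) * A) := by
          simp only [div_eq_mul_inv]; ring
      _ ≤ D / t * ∫⁻ x in ball b.1 b.2, f x * maximalFn μ v x ∂μ := by
          gcongr
          refine (lintegral_mul_const_le _ _).trans ?_
          refine setLIntegral_mono' measurableSet_ball fun x hx => ?_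
          gcongr
          exact le_maximalFn (ball_subset_ball (by linarith) hx)
  have : Countable u := hucount
  calc ∫⁻ x in {x | t < maximalFn μ f x}, v x ∂μ
      ≤ ∫⁻ x in ⋃ b ∈ u, ball b.1 (4 * b.2), v x ∂μ := lintegral_mono_set hsub
    _ ≤ ∑' b : u, ∫⁻ x in ball b.1.1 (4 * b.1.2), v x ∂μ := by
        rw [biUnion_eq_iUnion]; exact lintegral_iUnion_le _ _
    _ ≤ ∑' b : u, D / t * ∫⁻ x in ball b.1.1 b.1.2, f x * maximalFn μ v x ∂μ :=
        ENNReal.tsum_le_tsum fun b => hone b b.2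
    _ = D / t * ∫⁻ x in ⋃ b ∈ u, ball b.1 b.2, f x * maximalFn μ v x ∂μ := by
        rw [ENNReal.tsum_mul_left, lintegral_biUnion hucount (fun _ _ => measurableSet_ball) hdisj]
    _ ≤ D / t * ∫⁻ x, f x * maximalFn μ v x ∂μ := by
        gcongr; exact Measure.restrict_le_self

/-- The Fefferman–Stein weighted inequality for the maximal function. -/
lemma IsDoublingOn.fefferman_stein [OpensMeasurableSpace X] [SecondCountableTopology X]
    [BoundedSpace X] [SFinite μ] (hμ : IsDoublingOn μ D) {q : ℝ} (hq : 1 < q) :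
    ∃ C : ℝ≥0, ∀ f v : X → ℝ≥0∞, Measurable f → Measurable v →
      ∫⁻ x, maximalFn μ f x ^ q * v x ∂μ ≤ C * ∫⁻ x, f x ^ q * maximalFn μ v x ∂μ := by
  have hq0 : 0 < q := by linarith
  have hq1 : 0 < q - 1 := by linarith
  -- The factor `q` comes from the layer-cake formula, `2 D` from the weak type at level `t/2`, and
  -- the last factor from integrating `t^(q-2)` over `0 < t < 2 f x`.
  refine ⟨q.toNNReal * (2 * D) * ((2 : ℝ≥0) ^ (q - 1) / (q - 1).toNNReal), fun f v hf hv => ?_⟩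
  have hM := measurable_maximalFn (μ := μ) f
  have hMv := measurable_maximalFn (μ := μ) v
  -- Marcinkiewicz truncation: the part of `f` below `t/2` contributes at most `t/2` to the maximal
  -- function, so only the part with `2 f > t` matters at level `t`.
  have htrunc : ∀ t : ℝ, 0 < t → ∫⁻ x in {x | ENNReal.ofReal t < maximalFn μ f x}, v x ∂μ ≤
      ENNReal.ofReal t⁻¹ * (2 * D) * ∫⁻ x, {x | ENNReal.ofReal t < 2 * f x}.indicator
        (fun x => f x * maximalFn μ v x) x ∂μ := by
    intro t ht
    set T := ENNReal.ofReal (t / 2) with hT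
    have hTT : ENNReal.ofReal t = T + T := by
      rw [hT, ← ENNReal.ofReal_add (by positivity) (by positivity), add_halves]
    have hms : MeasurableSet {x | ENNReal.ofReal t < 2 * f x} :=
      measurableSet_lt measurable_const (hf.const_mul _)
    set g := {x | ENNReal.ofReal t < 2 * f x}.indicator f with hg
    have hfg : ∀ x, f x ≤ g x + T := by
      intro x
      by_cases hx : ENNReal.ofReal t < 2 * f x
      · have : g x = f x := indicator_of_mem (s := {x | ENNReal.ofReal t < 2 * f x}) hx f
        rw [this]; exact le_self_add
      · refine le_add_left ?_
        rw [not_lt, hTT, ← two_mul] at hx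
        exact (ENNReal.mul_le_mul_iff_right (by simp) (by simp)).1 hx
    have hsub : {x | ENNReal.ofReal t < maximalFn μ f x} ⊆ {x | T < maximalFn μ g x} := by
      intro x hx
      have h1 : T + T < maximalFn μ g x + T := by
        rw [← hTT]
        exact lt_of_lt_of_le hx ((maximalFn_mono_ae (.of_forall hfg) x).trans
          (maximalFn_add_const_le (hf.indicator hms) T x))
      exact lt_of_add_lt_add_right h1
    refine (lintegral_mono_set hsub).trans
      ((hμ.weak_type g v (by simpa [hT] using ht) ENNReal.ofReal_ne_top).trans ?_)
    have : (D : ℝ≥0∞) / T = ENNReal.ofReal t⁻¹ * (2 * D) := by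
      rw [hT, ENNReal.ofReal_div_of_pos two_pos, ENNReal.ofReal_inv_of_pos ht,
        div_eq_mul_inv, ENNReal.inv_div (by simp) (by simp)]
      simp only [div_eq_mul_inv, ENNReal.ofReal_ofNat]; ring
    rw [this]
    gcongr with x
    by_cases hx : x ∈ {x | ENNReal.ofReal t < 2 * f x} <;> simp [hg, hx]
  have hkey : ∀ x, maximalFn μ f x ^ q * v x = ENNReal.ofReal q *
      ∫⁻ t in Ioi (0 : ℝ), ENNReal.ofReal (t ^ (q - 1)) *
        {x | ENNReal.ofReal t < maximalFn μ f x}.indicator v x := by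
    intro x
    have h := lintegral_indicator_lt_rpow (maximalFn μ f x) hq0
    have h' : maximalFn μ f x ^ q = ENNReal.ofReal q *
        (maximalFn μ f x ^ q / ENNReal.ofReal q) := by
      rw [ENNReal.mul_div_cancel (by simpa using hq0) ENNReal.ofReal_ne_top]
    rw [h', ← h, mul_assoc]
    congr 1
    rw [← lintegral_mul_const]
    · refine lintegral_congr fun t => ?_
      by_cases hx : ENNReal.ofReal t < maximalFn μ f x <;> simp [indicator, hx]
    · exact Measurable.indicator (by fun_prop) (measurableSet_lt (by fun_prop) (by fun_prop))
  have hmeas1 : Measurable (Function.uncurry fun (x : X) (t : ℝ) => ENNReal.ofReal (t ^ (q - 1)) *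
        {x | ENNReal.ofReal t < maximalFn μ f x}.indicator v x) := by
    refine Measurable.mul (by fun_prop) ?_
    exact Measurable.indicator (f := fun z : X × ℝ => v z.1)
      (s := {z : X × ℝ | ENNReal.ofReal z.2 < maximalFn μ f z.1}) (by fun_prop)
      (measurableSet_lt (by fun_prop) (by fun_prop))
  have hmeas2 : Measurable (Function.uncurry fun (t : ℝ) (x : X) => ENNReal.ofReal (t ^ (q - 2)) *
        {x | ENNReal.ofReal t < 2 * f x}.indicator (fun x => f x * maximalFn μ v x) x) := by
    refine Measurable.mul (by fun_prop) ?_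
    exact Measurable.indicator (f := fun z : ℝ × X => f z.2 * maximalFn μ v z.2)
      (s := {z : ℝ × X | ENNReal.ofReal z.1 < 2 * f z.2}) (by fun_prop)
      (measurableSet_lt (by fun_prop) (by fun_prop))
  simp only [hkey]
  rw [lintegral_const_mul' _ _ ENNReal.ofReal_ne_top,
    lintegral_lintegral_swap hmeas1.aemeasurable]
  have hinner : ∀ t ∈ Ioi (0 : ℝ), ∫⁻ x, ENNReal.ofReal (t ^ (q - 1)) *
        {x | ENNReal.ofReal t < maximalFn μ f x}.indicator v x ∂μ ≤
      (2 * D) * ∫⁻ x, ENNReal.ofReal (t ^ (q - 2)) *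
        {x | ENNReal.ofReal t < 2 * f x}.indicator (fun x => f x * maximalFn μ v x) x ∂μ := by
    intro t ht
    have ht' : 0 < t := ht
    rw [lintegral_const_mul' _ _ ENNReal.ofReal_ne_top,
      lintegral_const_mul' _ _ ENNReal.ofReal_ne_top,
      lintegral_indicator (measurableSet_lt (by fun_prop) (by fun_prop))]
    refine (mul_le_mul_right (htrunc t ht) _).trans (le_of_eq ?_)
    have : ENNReal.ofReal (t ^ (q - 1)) * ENNReal.ofReal t⁻¹ = ENNReal.ofReal (t ^ (q - 2)) := by
      rw [← ENNReal.ofReal_mul (by positivity), ← Real.rpow_neg_one, ← Real.rpow_add ht']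
      congr 2; ring
    rw [← this]; ring
  have hfin : ∀ x, ∫⁻ t in Ioi (0 : ℝ), ENNReal.ofReal (t ^ (q - 2)) *
        {x | ENNReal.ofReal t < 2 * f x}.indicator (fun x => f x * maximalFn μ v x) x =
      ((2 : ℝ≥0) ^ (q - 1) / (q - 1).toNNReal : ℝ≥0) * (f x ^ q * maximalFn μ v x) := by
    intro x
    have h := lintegral_indicator_lt_rpow (2 * f x) hq1
    have h2 : ∫⁻ t in Ioi (0 : ℝ), ENNReal.ofReal (t ^ (q - 2)) *
        {x | ENNReal.ofReal t < 2 * f x}.indicator (fun x => f x * maximalFn μ v x) x =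
        (2 * f x) ^ (q - 1) / ENNReal.ofReal (q - 1) * (f x * maximalFn μ v x) := by
      rw [← h, ← lintegral_mul_const]
      · refine lintegral_congr fun t => ?_
        by_cases hx : ENNReal.ofReal t < 2 * f x <;> simp [indicator, hx, sub_sub, one_add_one_eq_two]
      · exact Measurable.indicator (by fun_prop) (measurableSet_lt (by fun_prop) (by fun_prop))
    have hfq : f x ^ q = f x ^ (q - 1) * f x := by
      conv_lhs => rw [← sub_add_cancel q 1]
      rw [ENNReal.rpow_add_of_nonneg _ _ hq1.le zero_le_one, ENNReal.rpow_one]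
    rw [h2, hfq, ENNReal.mul_rpow_of_nonneg _ _ hq1.le, ENNReal.coe_div (by simpa using hq),
      ENNReal.coe_rpow_of_nonneg _ hq1.le]
    simp only [div_eq_mul_inv, ENNReal.ofReal, ENNReal.coe_ofNat]
    ring
  calc ENNReal.ofReal q * ∫⁻ t in Ioi (0 : ℝ), ∫⁻ x, ENNReal.ofReal (t ^ (q - 1)) *
        {x | ENNReal.ofReal t < maximalFn μ f x}.indicator v x ∂μ
      ≤ ENNReal.ofReal q * ∫⁻ t in Ioi (0 : ℝ), (2 * D) * ∫⁻ x, ENNReal.ofReal (t ^ (q - 2)) *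
        {x | ENNReal.ofReal t < 2 * f x}.indicator (fun x => f x * maximalFn μ v x) x ∂μ := by
        gcongr 1
        exact setLIntegral_mono' measurableSet_Ioi hinner
    _ = _ := by
        rw [lintegral_const_mul' _ _ (by finiteness),
          lintegral_lintegral_swap hmeas2.aemeasurable]
        simp only [hfin]
        rw [lintegral_const_mul' _ _ ENNReal.coe_ne_top]
        simp only [ENNReal.coe_mul, ENNReal.ofReal, ENNReal.coe_ofNat]
        ring

end Maximal

/-! ### From weighted scalar bounds to vector-valued inequalities. -/

section VectorValued

variable {X : Type*} [PseudoMetricSpace X] [MeasurableSpace X] {μ ν : Measure X} {D : ℝ≥0}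

lemma maximalFn_le_rpow_mul_rpow {f g h : X → ℝ≥0∞} (hg : Measurable g) (hh : Measurable h)
    {a b : ℝ} (ha : 0 ≤ a) (hb : 0 ≤ b) (hab : a + b = 1)
    (hf : ∀ᵐ y ∂μ, f y ≤ g y ^ a * h y ^ b) (x : X) :
    maximalFn μ f x ≤ maximalFn μ g x ^ a * maximalFn μ h x ^ b := by
  refine maximalFn_le fun z r hx => ?_
  have h1 : ∫⁻ y in ball z r, f y ∂μ ≤
      (∫⁻ y in ball z r, g y ∂μ) ^ a * (∫⁻ y in ball z r, h y ∂μ) ^ b :=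
    (lintegral_mono_ae (ae_restrict_of_ae hf)).trans
      (ENNReal.lintegral_mul_norm_pow_le hg.aemeasurable hh.aemeasurable ha hb hab)
  have h2 : μ (ball z r) = μ (ball z r) ^ a * μ (ball z r) ^ b := by
    rw [← ENNReal.rpow_add_of_nonneg _ _ ha hb, hab, ENNReal.rpow_one]
  calc (∫⁻ y in ball z r, f y ∂μ) / μ (ball z r)
      ≤ (∫⁻ y in ball z r, g y ∂μ) ^ a * (∫⁻ y in ball z r, h y ∂μ) ^ b / μ (ball z r) :=
        ENNReal.div_le_div_right h1 _
    _ ≤ ((∫⁻ y in ball z r, g y ∂μ) / μ (ball z r)) ^ a *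
        ((∫⁻ y in ball z r, h y ∂μ) / μ (ball z r)) ^ b := by
        rw [ENNReal.div_rpow_of_nonneg _ _ ha, ENNReal.div_rpow_of_nonneg _ _ hb]
        simp only [div_eq_mul_inv]
        rw [mul_mul_mul_comm]
        gcongr
        -- For a null ball the left side is `∞` by convention, so the right side has to be shown
        -- infinite too.
        by_cases h0 : μ (ball z r) = 0
        · rw [h0]
          rcases ha.eq_or_lt with rfl | ha'
          · obtain rfl : b = 1 := by linarith
            simp
          · have hb' : ((0 : ℝ≥0∞) ^ b)⁻¹ ≠ 0 := by
              simp [ENNReal.rpow_eq_top_iff, hb.not_gt]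
            rw [ENNReal.zero_rpow_of_pos ha', ENNReal.inv_zero, ENNReal.top_mul hb']
        · rw [← ENNReal.mul_inv, ← h2]
          · left; simp [ENNReal.rpow_eq_zero_iff, h0, ha.not_gt]
          · right; simp [ENNReal.rpow_eq_zero_iff, h0, hb.not_gt]
    _ ≤ _ := by
        gcongr
        · exact le_maximalFn hx
        · exact le_maximalFn hx

lemma lintegral_rpow_eq_iSup_min {Y : Type*} [MeasurableSpace Y] {ν : Measure Y} {G : Y → ℝ≥0∞} (hG : Measurable G) {P : ℝ}
    (hP : 0 < P) : ∫⁻ x, G x ^ P ∂ν = ⨆ N : ℕ, ∫⁻ x, min (G x) N ^ P ∂ν := by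
  rw [← lintegral_iSup (fun N => by fun_prop)]
  · refine lintegral_congr fun x => ?_
    have h : G x = ⨆ N : ℕ, min (G x) N := by
      rw [← inf_iSup_eq, ENNReal.iSup_natCast]; simp
    conv_lhs => rw [h]
    exact (ENNReal.orderIsoRpow P hP).map_iSup _
  · intro m n hmn x
    dsimp only
    gcongr

/-- Absorption of `a ^ (1/s)` into the left side. Finiteness of `a` is essential, which is why the
argument below is run on truncations. -/
lemma ENNReal.le_rpow_of_le_mul_rpow {a b : ℝ≥0∞} {P s : ℝ} (hPs : P.HolderConjugate s)
    (ha : a ≠ ∞) (h : a ≤ b * a ^ (1 / s)) : a ≤ b ^ P := by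
  rcases eq_or_ne a 0 with rfl | ha0
  · exact zero_le
  have hs0 : a ^ (1 / s) ≠ 0 := by simp [ENNReal.rpow_eq_zero_iff, ha0, ha]
  have hst : a ^ (1 / s) ≠ ∞ := ENNReal.rpow_ne_top_of_ne_zero ha0 ha
  have h1 : a ^ (1 / P) * a ^ (1 / s) = a := by
    rw [← ENNReal.rpow_add _ _ ha0 ha, one_div, one_div, hPs.inv_add_inv_eq_one, ENNReal.rpow_one]
  have h2 : a ^ (1 / P) ≤ b := by
    rw [← h1] at h
    conv_rhs at h => rw [h1]
    exact (ENNReal.mul_le_mul_iff_left hs0 hst).1 h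
  calc a = (a ^ (1 / P)) ^ P := by rw [one_div, ENNReal.rpow_inv_rpow hPs.pos.ne']
    _ ≤ b ^ P := ENNReal.rpow_le_rpow h2 hPs.pos.le

variable [OpensMeasurableSpace X]

/-- Boundedness of the maximal function on the dual weighted space implies an `ℓ^q`-valued
inequality. -/
lemma IsDoublingOn.vector_valued_of_dual [SecondCountableTopology X] [BoundedSpace X] [SFinite μ]
    (hμ : IsDoublingOn μ D) {w : X → ℝ≥0∞} (hw : Measurable w)
    (hw0 : ∀ᵐ x ∂μ, w x ≠ 0 ∧ w x ≠ ∞) [IsFiniteMeasure (μ.withDensity w)]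
    {q P s : ℝ} (hq : 1 < q) (hPs : P.HolderConjugate s) {A : ℝ≥0}
    (hA : ∀ g : X → ℝ≥0∞, Measurable g →
      ∫⁻ x, maximalFn μ g x ^ s * w x ^ (1 - s) ∂μ ≤ A * ∫⁻ x, g x ^ s * w x ^ (1 - s) ∂μ) :
    ∃ C : ℝ≥0, ∀ f : ℕ → X → ℝ≥0∞, (∀ j, Measurable (f j)) →
      ∫⁻ x, (∑' j, maximalFn μ (f j) x ^ q) ^ P ∂(μ.withDensity w) ≤
        C * ∫⁻ x, (∑' j, f j x ^ q) ^ P ∂(μ.withDensity w) := by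
  obtain ⟨C, hC⟩ := hμ.fefferman_stein hq
  have hP0 : 0 < P := hPs.pos
  have hP1 : 0 < P - 1 := sub_pos.2 hPs.lt
  have hs0 : 0 < s := hPs.symm.pos
  refine ⟨(C * A ^ (1 / s)) ^ P, fun f hf => ?_⟩
  set G : X → ℝ≥0∞ := fun x => ∑' j, maximalFn μ (f j) x ^ q with hG
  set H : X → ℝ≥0∞ := fun x => ∑' j, f j x ^ q with hH
  have hGm : Measurable G :=
    Measurable.tsum fun j => (measurable_maximalFn (f j)).pow_const q
  have hHm : Measurable H := Measurable.tsum fun j => (hf j).pow_const q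
  -- Hölder after inserting `w^(1/P) w^(-1/P)`; conjugacy gives `-s/P = 1 - s`.
  have hHolder : ∀ K : X → ℝ≥0∞, Measurable K → ∫⁻ x, H x * K x ∂μ ≤
      (∫⁻ x, H x ^ P ∂(μ.withDensity w)) ^ (1 / P) *
        (∫⁻ x, K x ^ s * w x ^ (1 - s) ∂μ) ^ (1 / s) := by
    intro K hK
    calc ∫⁻ x, H x * K x ∂μ
        ≤ ∫⁻ x, (H x * w x ^ (1 / P)) * (K x * w x ^ (-(1 / P))) ∂μ := by
          refine lintegral_mono_ae ?_
          filter_upwards [hw0] with x hx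
          rw [mul_mul_mul_comm, ← ENNReal.rpow_add _ _ hx.1 hx.2]
          simp
      _ ≤ _ := ENNReal.lintegral_mul_le_Lp_mul_Lq μ hPs (by fun_prop) (by fun_prop)
      _ = _ := by
          have e1 : ∀ x, (H x * w x ^ (1 / P)) ^ P = w x * H x ^ P := by
            intro x
            rw [ENNReal.mul_rpow_of_nonneg _ _ hP0.le, ← ENNReal.rpow_mul, one_div,
              inv_mul_cancel₀ hP0.ne', ENNReal.rpow_one, mul_comm]
          have e2 : ∀ x, (K x * w x ^ (-(1 / P))) ^ s = K x ^ s * w x ^ (1 - s) := by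
            intro x
            rw [ENNReal.mul_rpow_of_nonneg _ _ hs0.le, ← ENNReal.rpow_mul]
            congr 2
            have := hPs.inv_add_inv_eq_one
            field_simp at this ⊢
            linarith
          simp only [e1, e2]
          rw [lintegral_withDensity_eq_lintegral_mul _ hw (hHm.pow_const P)]
          rfl
  have hN : ∀ N : ℕ, ∫⁻ x, min (G x) N ^ P ∂(μ.withDensity w) ≤
      ((C * A ^ (1 / s)) ^ P : ℝ≥0) * ∫⁻ x, H x ^ P ∂(μ.withDensity w) := by
    intro N
    set I := ∫⁻ x, min (G x) N ^ P ∂(μ.withDensity w) with hI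
    -- The extremal function for `L^P`–`L^s` duality, truncated: since `(P-1)s = P`, its `s`-th
    -- power is `min(G,N)^P`.
    set φ : X → ℝ≥0∞ := fun x => min (G x) N ^ (P - 1) with hφ
    have hφm : Measurable φ := (hGm.min measurable_const).pow_const _
    have hIfin : I ≠ ∞ := by
      refine ne_top_of_le_ne_top ?_ (lintegral_mono (g := fun _ => (N : ℝ≥0∞) ^ P) fun x => ?_)
      · rw [lintegral_const]
        exact ENNReal.mul_ne_top (by finiteness) (measure_ne_top _ _)
      · exact ENNReal.rpow_le_rpow (min_le_right _ _) hP0.le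
    have h1 : I ≤ ∫⁻ x, G x * (φ x * w x) ∂μ := by
      rw [hI, lintegral_withDensity_eq_lintegral_mul _ hw (by fun_prop)]
      refine lintegral_mono fun x => ?_
      have : min (G x) N ^ P = min (G x) N * φ x := by
        conv_lhs => rw [← add_sub_cancel 1 P]
        rw [ENNReal.rpow_add_of_nonneg _ _ zero_le_one hP1.le, ENNReal.rpow_one]
      simp only [Pi.mul_apply, this]
      rw [mul_comm (w x), mul_assoc]
      gcongr
      exact min_le_left _ _
    -- The Fefferman–Stein inequality is used termwise with the common weight `φ w`, so a single
    -- maximal function appears on the right.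
    have h2 : ∫⁻ x, G x * (φ x * w x) ∂μ ≤ C * ∫⁻ x, H x * maximalFn μ (φ * w) x ∂μ := by
      simp only [hG, hH, ← ENNReal.tsum_mul_right]
      have hm1 : ∀ j, Measurable fun x => maximalFn μ (f j) x ^ q * (φ x * w x) :=
        fun j => ((measurable_maximalFn (f j)).pow_const q).mul (hφm.mul hw)
      have hm2 : ∀ j, Measurable fun x => f j x ^ q * maximalFn μ (φ * w) x :=
        fun j => ((hf j).pow_const q).mul (measurable_maximalFn _)
      rw [lintegral_tsum fun j => (hm1 j).aemeasurable,
        lintegral_tsum fun j => (hm2 j).aemeasurable, ← ENNReal.tsum_mul_left]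
      exact ENNReal.tsum_le_tsum fun j => hC (f j) (φ * w) (hf j) (hφm.mul hw)
    -- The dual bound `hA` for `g = φ w`: here `(φ w)^s w^(1-s) = φ^s w`, whose integral is at most
    -- `I`.
    have h3 : ∫⁻ x, maximalFn μ (φ * w) x ^ s * w x ^ (1 - s) ∂μ ≤ A * I := by
      refine (hA _ (hφm.mul hw)).trans ?_
      gcongr
      rw [hI, lintegral_withDensity_eq_lintegral_mul _ hw (by fun_prop)]
      refine lintegral_mono_ae ?_
      filter_upwards [hw0] with x hx
      simp only [Pi.mul_apply]
      rw [ENNReal.mul_rpow_of_nonneg _ _ hs0.le, mul_assoc, ← ENNReal.rpow_add _ _ hx.1 hx.2,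
        add_sub_cancel, ENNReal.rpow_one, mul_comm, hφ]
      dsimp only
      rw [← ENNReal.rpow_mul, hPs.sub_one_mul_conj]
    have h4 : I ≤ (C * (A ^ (1 / s) : ℝ≥0) *
        (∫⁻ x, H x ^ P ∂(μ.withDensity w)) ^ (1 / P)) * I ^ (1 / s) := by
      refine (h1.trans h2).trans ?_
      calc (C : ℝ≥0∞) * ∫⁻ x, H x * maximalFn μ (φ * w) x ∂μ
          ≤ C * ((∫⁻ x, H x ^ P ∂(μ.withDensity w)) ^ (1 / P) * (A * I) ^ (1 / s)) := by
            gcongr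
            refine (hHolder _ (measurable_maximalFn _)).trans ?_
            gcongr
        _ = _ := by
            rw [ENNReal.mul_rpow_of_nonneg _ _ (by positivity),
              ENNReal.coe_rpow_of_nonneg _ (by positivity)]
            ring
    refine (ENNReal.le_rpow_of_le_mul_rpow hPs hIfin h4).trans (le_of_eq ?_)
    rw [ENNReal.mul_rpow_of_nonneg _ _ hP0.le, ← ENNReal.rpow_mul, one_div_mul_cancel hP0.ne',
      ENNReal.rpow_one, ← ENNReal.coe_mul, ENNReal.coe_rpow_of_nonneg _ hP0.le]
  rw [lintegral_rpow_eq_iSup_min hGm hP0]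
  exact iSup_le hN

/-- An `ℓ^q`-valued inequality for the maximal function implies the `ℓ^Q`-valued ones, `q < Q`. -/
lemma maximalFn_vector_valued_mono {q Q p : ℝ} (hq : 0 < q) (hqQ : q < Q) (hp : 0 < p)
    (hμν : μ ≪ ν) {C : ℝ≥0}
    (hC : ∀ f : ℕ → X → ℝ≥0∞, (∀ j, Measurable (f j)) →
      ∫⁻ x, (∑' j, maximalFn μ (f j) x ^ q) ^ (p / q) ∂ν ≤
        C * ∫⁻ x, (∑' j, f j x ^ q) ^ (p / q) ∂ν)
    {f : ℕ → X → ℝ≥0∞} (hf : ∀ j, Measurable (f j)) :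
    ∫⁻ x, (∑' j, maximalFn μ (f j) x ^ Q) ^ (p / Q) ∂ν ≤
      (C + 1) * ∫⁻ x, (∑' j, f j x ^ Q) ^ (p / Q) ∂ν := by
  have hQ : 0 < Q := hq.trans hqQ
  set a := q / Q with ha
  have ha0 : 0 < a := by positivity
  have ha1 : a < 1 := (div_lt_one hQ).2 hqQ
  set b := 1 - a with hb
  have hb0 : 0 < b := by linarith
  have haQ : a * Q = q := div_mul_cancel₀ _ hQ.ne'
  set F : X → ℝ≥0∞ := fun x => (∑' j, f j x ^ Q) ^ (1 / Q) with hF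
  have hFm : Measurable F :=
    (Measurable.tsum fun j => (hf j).pow_const Q).pow_const _
  have hFQ : ∀ x, F x ^ Q = ∑' j, f j x ^ Q := fun x => by
    rw [hF]; dsimp only; rw [one_div, ENNReal.rpow_inv_rpow hQ.ne']
  have hFp : ∀ x, (∑' j, f j x ^ Q) ^ (p / Q) = F x ^ p := fun x => by
    rw [← hFQ, ← ENNReal.rpow_mul, mul_div_cancel₀ _ hQ.ne']
  simp only [hFp]
  -- The `+ 1` in the constant keeps the right side infinite in the first case even if `C = 0`.
  rcases eq_or_ne (∫⁻ x, F x ^ p ∂ν) ∞ with htop | hfin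
  · rw [htop, ENNReal.mul_top (by simp)]; exact le_top
  have hFfin : ∀ᵐ x ∂μ, F x ≠ ∞ := by
    refine hμν.ae_le ?_
    filter_upwards [ae_lt_top (hFm.pow_const p) hfin] with x hx h
    rw [h, ENNReal.top_rpow_of_pos hp] at hx
    exact hx.ne rfl
  -- Chosen so that `f_j = g_j^a F^b` and `∑ g_j^q = F^q` wherever `0 < F < ∞`: the `ℓ^q` inequality
  -- then applies to `g` with right side `∫ F^p`.
  set g : ℕ → X → ℝ≥0∞ := fun j x => f j x ^ (1 / a) * F x ^ (-(b / a)) with hg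
  have hgm : ∀ j, Measurable (g j) := fun j => ((hf j).pow_const _).mul (hFm.pow_const _)
  have hfle : ∀ j x, f j x ≤ F x := by
    intro j x
    refine (ENNReal.rpow_le_rpow_iff hQ).1 ?_
    rw [hFQ]
    exact ENNReal.le_tsum j
  have hfg : ∀ j, ∀ᵐ x ∂μ, f j x ≤ g j x ^ a * F x ^ b := by
    intro j
    filter_upwards [hFfin] with x hx
    rcases eq_or_ne (F x) 0 with h0 | h0
    · have := hfle j x
      rw [h0] at this
      exact this.trans zero_le
    · rw [hg]; dsimp only
      rw [ENNReal.mul_rpow_of_nonneg _ _ ha0.le, ← ENNReal.rpow_mul, ← ENNReal.rpow_mul,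
        one_div_mul_cancel ha0.ne', ENNReal.rpow_one, mul_assoc, ← ENNReal.rpow_add _ _ h0 hx]
      have : -(b / a) * a + b = 0 := by field_simp; ring
      rw [this, ENNReal.rpow_zero, mul_one]
  have hM : ∀ j x, maximalFn μ (f j) x ≤ maximalFn μ (g j) x ^ a * maximalFn μ F x ^ b :=
    fun j x => maximalFn_le_rpow_mul_rpow (hgm j) hFm ha0.le hb0.le (by ring) (hfg j) x
  have hgq : ∀ x, (∑' j, g j x ^ q) ^ (p / q) ≤ F x ^ p := by
    intro x
    have e : ∀ j, g j x ^ q = f j x ^ Q * F x ^ (-(b * Q)) := by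
      intro j
      rw [hg]; dsimp only
      rw [ENNReal.mul_rpow_of_nonneg _ _ hq.le, ← ENNReal.rpow_mul, ← ENNReal.rpow_mul, ← haQ]
      congr 2 <;> field_simp
    have hle : ∑' j, g j x ^ q ≤ F x ^ q := by
      simp only [e]
      rw [ENNReal.tsum_mul_right, ← hFQ]
      rcases eq_or_ne (F x) 0 with h0 | h0
      · simp [h0, ENNReal.zero_rpow_of_pos hQ]
      rcases eq_or_ne (F x) ∞ with ht | ht
      · rw [ht, ENNReal.top_rpow_of_neg (neg_lt_zero.2 (by positivity))]; simp
      rw [← ENNReal.rpow_add _ _ h0 ht, ← haQ, hb]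
      refine le_of_eq ?_
      congr 1; ring
    calc (∑' j, g j x ^ q) ^ (p / q) ≤ (F x ^ q) ^ (p / q) :=
          ENNReal.rpow_le_rpow hle (by positivity)
      _ = F x ^ p := by rw [← ENNReal.rpow_mul, mul_div_cancel₀ _ hq.ne']
  set S : X → ℝ≥0∞ := fun x => ∑' j, maximalFn μ (g j) x ^ q with hS
  have hSm : Measurable S :=
    Measurable.tsum fun j => (measurable_maximalFn (g j)).pow_const q
  have hpt : ∀ x, (∑' j, maximalFn μ (f j) x ^ Q) ^ (p / Q) ≤
      (S x ^ (p / q)) ^ a * (maximalFn μ F x ^ p) ^ b := by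
    intro x
    have h1 : ∑' j, maximalFn μ (f j) x ^ Q ≤ S x * maximalFn μ F x ^ (b * Q) := by
      rw [hS]; dsimp only
      rw [← ENNReal.tsum_mul_right]
      refine ENNReal.tsum_le_tsum fun j => ?_
      refine (ENNReal.rpow_le_rpow (hM j x) hQ.le).trans (le_of_eq ?_)
      rw [ENNReal.mul_rpow_of_nonneg _ _ hQ.le, ← ENNReal.rpow_mul, ← ENNReal.rpow_mul, haQ]
    refine (ENNReal.rpow_le_rpow h1 (by positivity)).trans (le_of_eq ?_)
    rw [ENNReal.mul_rpow_of_nonneg _ _ (by positivity), ← ENNReal.rpow_mul, ← ENNReal.rpow_mul,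
      ← ENNReal.rpow_mul]
    congr 2
    · rw [ha]; field_simp
    · field_simp
  -- The scalar bound for `F` is the vector inequality for a sequence with one nonzero term.
  have hMF : ∫⁻ x, maximalFn μ F x ^ p ∂ν ≤ C * ∫⁻ x, F x ^ p ∂ν := by
    have h := hC (fun j => if j = 0 then F else fun _ => 0)
      (fun j => by split_ifs; exacts [hFm, measurable_const])
    have e1 : ∀ x, ∑' j : ℕ, maximalFn μ (if j = 0 then F else fun _ => 0) x ^ q =
        maximalFn μ F x ^ q := by
      intro x
      rw [tsum_eq_single 0]
      · simp
      · intro j hj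
        simp [hj, maximalFn_zero, hq]
    have e2 : ∀ x, ∑' j : ℕ, (if j = 0 then F else fun _ => 0) x ^ q = F x ^ q := by
      intro x
      rw [tsum_eq_single 0]
      · simp
      · intro j hj
        simp [hj, hq]
    simpa only [e1, e2, ← ENNReal.rpow_mul, mul_div_cancel₀ p hq.ne'] using h
  have hSint : ∫⁻ x, S x ^ (p / q) ∂ν ≤ C * ∫⁻ x, F x ^ p ∂ν :=
    (hC g hgm).trans (by gcongr with x; exact hgq x)
  calc ∫⁻ x, (∑' j, maximalFn μ (f j) x ^ Q) ^ (p / Q) ∂ν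
      ≤ ∫⁻ x, (S x ^ (p / q)) ^ a * (maximalFn μ F x ^ p) ^ b ∂ν := lintegral_mono hpt
    _ ≤ (∫⁻ x, S x ^ (p / q) ∂ν) ^ a * (∫⁻ x, maximalFn μ F x ^ p ∂ν) ^ b :=
        ENNReal.lintegral_mul_norm_pow_le (hSm.pow_const _).aemeasurable
          ((measurable_maximalFn _).pow_const _).aemeasurable ha0.le hb0.le (by ring)
    _ ≤ (C * ∫⁻ x, F x ^ p ∂ν) ^ a * (C * ∫⁻ x, F x ^ p ∂ν) ^ b := by gcongr
    _ = C * ∫⁻ x, F x ^ p ∂ν := by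
        rw [← ENNReal.rpow_add_of_nonneg _ _ ha0.le hb0.le, hb, add_sub_cancel, ENNReal.rpow_one]
    _ ≤ _ := by gcongr; exact le_self_add

end VectorValued

/-! ### Polar coordinates, spherical shells and one-dimensional integrals. -/

section PolarCoordinates

variable {E : Type*} [NormedAddCommGroup E] [NormedSpace ℝ E] [MeasurableSpace E] [BorelSpace E]
  [FiniteDimensional ℝ E] [Nontrivial E] (μ : Measure E) [μ.IsAddHaarMeasure]

/-- Taking `h` to be the indicator of a thin shell turns an integral over the sphere into one over
the ambient space, where the power weights factor into coordinates. -/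
lemma lintegral_polar {g : E → ℝ≥0∞} (hg : Measurable g) {h : ℝ → ℝ≥0∞} (hh : Measurable h) :
    ∫⁻ z, g (‖z‖⁻¹ • z) * h ‖z‖ ∂μ = (∫⁻ y : sphere (0 : E) 1, g y ∂μ.toSphere) *
      ∫⁻ s : Ioi (0 : ℝ), h s ∂(Measure.volumeIoiPow (Module.finrank ℝ E - 1)) := by
  rw [← lintegral_prod_mul (by fun_prop) (by fun_prop),
    ← μ.measurePreserving_homeomorphUnitSphereProd.lintegral_comp_emb
      (Homeomorph.measurableEmbedding _)]
  simp only [homeomorphUnitSphereProd_apply_snd_coe, homeomorphUnitSphereProd_apply_fst_coe]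
  rw [lintegral_subtype_comap (measurableSet_singleton _).compl
    (fun z => g (‖z‖⁻¹ • z) * h ‖z‖), restrict_compl_singleton]

end PolarCoordinates

lemma volumeIoiPow_shell (n : ℕ) (r : ℝ) :
    ∫⁻ s : Ioi (0 : ℝ), (Ioo 1 (1 + r)).indicator 1 (s : ℝ) ∂(Measure.volumeIoiPow n) =
      ∫⁻ s in Ioo 1 (1 + r), ENNReal.ofReal (s ^ n) := by
  have hm : Measurable fun s : Ioi (0 : ℝ) => (Ioo 1 (1 + r)).indicator (1 : ℝ → ℝ≥0∞) (s : ℝ) :=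
    (measurable_one.indicator measurableSet_Ioo).comp measurable_subtype_coe
  rw [Measure.volumeIoiPow, lintegral_withDensity_eq_lintegral_mul _ (by fun_prop) hm]
  simp only [Pi.mul_apply]
  rw [lintegral_subtype_comap measurableSet_Ioi
    (fun s : ℝ => ENNReal.ofReal (s ^ n) * (Ioo 1 (1 + r)).indicator 1 s),
    ← lintegral_indicator measurableSet_Ioi, ← lintegral_indicator measurableSet_Ioo]
  refine lintegral_congr fun s => ?_
  by_cases hs : s ∈ Ioo 1 (1 + r)
  · have : s ∈ Ioi (0 : ℝ) := mem_Ioi.2 (by linarith [hs.1])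
    simp only [indicator_of_mem this, indicator_of_mem hs, Pi.one_apply, mul_one]
  · by_cases h0 : s ∈ Ioi (0 : ℝ)
    · simp only [indicator_of_mem h0, indicator_of_notMem hs, mul_zero]
    · simp only [indicator_of_notMem h0, indicator_of_notMem hs]

lemma le_lintegral_shell (n : ℕ) (r : ℝ) :
    ENNReal.ofReal r ≤ ∫⁻ s in Ioo 1 (1 + r), ENNReal.ofReal (s ^ n) := by
  calc ENNReal.ofReal r = ∫⁻ s in Ioo 1 (1 + r), 1 := by simp
    _ ≤ _ := by
      refine setLIntegral_mono' measurableSet_Ioo fun s hs => ?_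
      rw [← ENNReal.ofReal_one]
      exact ENNReal.ofReal_le_ofReal (one_le_pow₀ hs.1.le)

lemma lintegral_shell_le (n : ℕ) {r R : ℝ} (hr : r ≤ R) (h0 : 0 ≤ r) :
    ∫⁻ s in Ioo 1 (1 + r), ENNReal.ofReal (s ^ n) ≤ ENNReal.ofReal ((1 + R) ^ n * r) := by
  calc ∫⁻ s in Ioo 1 (1 + r), ENNReal.ofReal (s ^ n)
      ≤ ∫⁻ s in Ioo 1 (1 + r), ENNReal.ofReal ((1 + R) ^ n) := by
        refine setLIntegral_mono' measurableSet_Ioo fun s hs => ?_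
        refine ENNReal.ofReal_le_ofReal (pow_le_pow_left₀ (by linarith [hs.1]) ?_ _)
        linarith [hs.2]
    _ = _ := by
        have : 0 ≤ 1 + R := by linarith
        rw [setLIntegral_const, Real.volume_Ioo, ← ENNReal.ofReal_mul (by positivity)]
        congr 2; ring

lemma lintegral_fin_prod {n : ℕ} {φ : Fin n → ℝ → ℝ≥0∞} (hφ : ∀ i, Measurable (φ i)) :
    ∫⁻ z : Fin n → ℝ, ∏ i, φ i (z i) = ∏ i, ∫⁻ t, φ i t := by
  induction n with
  | zero => simp [volume_pi]
  | succ n ih =>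
    have h := (volume_preserving_piFinSuccAbove (fun _ : Fin (n + 1) => ℝ) 0).symm
    rw [← h.lintegral_comp_emb (MeasurableEquiv.measurableEmbedding _)]
    simp only [MeasurableEquiv.piFinSuccAbove_symm_apply, Fin.insertNthEquiv_zero, Fin.prod_univ_succ]
    have : ∀ a : ℝ × (Fin n → ℝ), φ 0 ((Fin.consEquiv fun _ => ℝ) a 0) *
        ∏ i : Fin n, φ i.succ ((Fin.consEquiv fun _ => ℝ) a i.succ) =
        φ 0 a.1 * ∏ i : Fin n, φ i.succ (a.2 i) := by
      intro a; simp [Fin.consEquiv]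
    simp only [this]
    have hm : Measurable fun z : Fin n → ℝ => ∏ i : Fin n, φ i.succ (z i) :=
      Finset.measurable_prod _ fun i _ => (hφ i.succ).comp (measurable_pi_apply i)
    rw [Measure.volume_eq_prod, lintegral_prod_mul (hφ 0).aemeasurable hm.aemeasurable,
      ih fun i => hφ i.succ]

lemma lintegral_comp_abs {F : ℝ → ℝ≥0∞} :
    ∫⁻ z, F |z| = 2 * ∫⁻ z in Ioi 0, F z := by
  have h1 : ∫⁻ z in Ioi 0, F |z| = ∫⁻ z in Ioi 0, F z :=
    setLIntegral_congr_fun measurableSet_Ioi fun z hz => by rw [abs_of_pos hz]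
  have h2 : ∫⁻ z in Iic 0, F |z| = ∫⁻ z in Ioi 0, F z := by
    rw [← h1, ← (Measure.measurePreserving_neg (volume : Measure ℝ)).setLIntegral_comp_preimage_emb
      (MeasurableEquiv.neg ℝ).measurableEmbedding]
    simp [Measure.restrict_congr_set Ioi_ae_eq_Ici]
  rw [← lintegral_add_compl _ (measurableSet_Iic (a := (0 : ℝ))), compl_Iic, h1, h2, two_mul]

/-- Comparability of two numbers passes to powers of either sign, hence the `|α|`; it is what treats
positive and negative weight exponents together. -/
lemma rpow_le_rpow_abs_mul_rpow {u v l α : ℝ} (hu : 0 < u) (hv : 0 < v) (huv : u ≤ l * v)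
    (hvu : v ≤ l * u) : u ^ α ≤ l ^ |α| * v ^ α := by
  have hl : 0 < l := by
    by_contra h
    nlinarith
  rcases le_total 0 α with h | h
  · rw [abs_of_nonneg h, ← Real.mul_rpow hl.le hv.le]
    exact Real.rpow_le_rpow hu.le huv h
  · rw [abs_of_nonpos h]
    have h2 : (l * u) ^ α ≤ v ^ α := Real.rpow_le_rpow_of_nonpos hv hvu h
    rw [Real.mul_rpow hl.le hu.le] at h2
    calc u ^ α = l ^ (-α) * (l ^ α * u ^ α) := by
          rw [← mul_assoc, ← Real.rpow_add hl]; simp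
      _ ≤ _ := by gcongr

/-- Two regimes. If `a ≥ 4r`, the weight is essentially constant on the window, as `|z| ≥ a/2`. If
`a < 4r`, the window lies in `|z| < 6r` and `a + r` is comparable to `r`; there `α > -1` gives
integrability at the origin. -/
lemma exists_lintegral_abs_rpow_le {α : ℝ} (hα : -1 < α) :
    ∃ C : ℝ, 0 < C ∧ ∀ a r : ℝ, 0 ≤ a → 0 < r →
      ∫⁻ z, {z : ℝ | abs (|z| - a) < 2 * r}.indicator (fun z => ENNReal.ofReal (|z| ^ α)) z ≤
        ENNReal.ofReal (C * (r * (a + r) ^ α)) := by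
  refine ⟨8 * (5 / 2) ^ |α| + 2 * (6 ^ (α + 1) / (α + 1)) * 5 ^ |α|, ?_, fun a r ha hr => ?_⟩
  · have : 0 < α + 1 := by linarith
    positivity
  have hα1 : 0 < α + 1 := by linarith
  have e : ∀ z : ℝ, {z : ℝ | abs (|z| - a) < 2 * r}.indicator
      (fun z => ENNReal.ofReal (|z| ^ α)) z = {t : ℝ | |t - a| < 2 * r}.indicator
      (fun t => ENNReal.ofReal (t ^ α)) |z| := fun z => rfl
  have hms : MeasurableSet {t : ℝ | |t - a| < 2 * r} :=
    measurableSet_lt (by fun_prop) (by fun_prop)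
  simp only [e]
  rw [lintegral_comp_abs (F := {t : ℝ | |t - a| < 2 * r}.indicator
      (fun t => ENNReal.ofReal (t ^ α))), lintegral_indicator hms, Measure.restrict_restrict hms]
  have har : 0 < a + r := by linarith
  rcases le_or_gt (4 * r) a with h4 | h4
  · calc 2 * ∫⁻ t in {t : ℝ | |t - a| < 2 * r} ∩ Ioi 0, ENNReal.ofReal (t ^ α)
        ≤ 2 * ∫⁻ t in {t : ℝ | |t - a| < 2 * r} ∩ Ioi 0,
            ENNReal.ofReal ((5 / 2) ^ |α| * (a + r) ^ α) := by
          gcongr 1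
          refine setLIntegral_mono' (hms.inter measurableSet_Ioi) fun t ht => ?_
          obtain ⟨h1, h2⟩ := abs_lt.1 (show |t - a| < 2 * r from ht.1)
          exact ENNReal.ofReal_le_ofReal
            (rpow_le_rpow_abs_mul_rpow ht.2 har (by linarith) (by linarith))
      _ ≤ 2 * (ENNReal.ofReal ((5 / 2) ^ |α| * (a + r) ^ α) * ENNReal.ofReal (4 * r)) := by
          rw [setLIntegral_const]
          gcongr
          calc volume ({t : ℝ | |t - a| < 2 * r} ∩ Ioi 0) ≤ volume (Ioo (a - 2 * r) (a + 2 * r)) := by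
                refine measure_mono fun t ht => ?_
                obtain ⟨h1, h2⟩ := abs_lt.1 (show |t - a| < 2 * r from ht.1)
                exact ⟨by linarith, by linarith⟩
            _ = ENNReal.ofReal (4 * r) := by rw [Real.volume_Ioo]; congr 1; ring
      _ = ENNReal.ofReal (8 * (5 / 2) ^ |α| * (r * (a + r) ^ α)) := by
          rw [← ENNReal.ofReal_ofNat 2, ← ENNReal.ofReal_mul (by positivity),
            ← ENNReal.ofReal_mul (by positivity)]
          congr 1; ring
      _ ≤ _ := by
          refine ENNReal.ofReal_le_ofReal (mul_le_mul_of_nonneg_right ?_ (by positivity))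
          have : 0 ≤ 2 * (6 ^ (α + 1) / (α + 1)) * 5 ^ |α| := by positivity
          linarith
  · calc 2 * ∫⁻ t in {t : ℝ | |t - a| < 2 * r} ∩ Ioi 0, ENNReal.ofReal (t ^ α)
        ≤ 2 * ∫⁻ t in Ioo 0 (6 * r), ENNReal.ofReal (t ^ (α + 1 - 1)) := by
          rw [add_sub_cancel_right]
          gcongr 1
          refine lintegral_mono_set fun t ht => ?_
          obtain ⟨h1, h2⟩ := abs_lt.1 (show |t - a| < 2 * r from ht.1)
          exact ⟨ht.2, by linarith⟩
      _ = ENNReal.ofReal (2 * (6 ^ (α + 1) / (α + 1)) * (r * r ^ α)) := by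
          rw [lintegral_Ioo_rpow (by positivity) hα1, ← ENNReal.ofReal_ofNat 2,
            ← ENNReal.ofReal_mul (by positivity), Real.mul_rpow (by positivity) hr.le,
            Real.rpow_add_one hr.ne']
          congr 1; ring
      _ ≤ _ := by
          refine ENNReal.ofReal_le_ofReal ?_
          have h5 : r ^ α ≤ 5 ^ |α| * (a + r) ^ α :=
            rpow_le_rpow_abs_mul_rpow hr har (by linarith) (by linarith)
          calc 2 * (6 ^ (α + 1) / (α + 1)) * (r * r ^ α)
              ≤ 2 * (6 ^ (α + 1) / (α + 1)) * (r * (5 ^ |α| * (a + r) ^ α)) := by gcongr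
            _ = 2 * (6 ^ (α + 1) / (α + 1)) * 5 ^ |α| * (r * (a + r) ^ α) := by ring
            _ ≤ _ := by
              refine mul_le_mul_of_nonneg_right ?_ (by positivity)
              have : 0 ≤ 8 * ((5 : ℝ) / 2) ^ |α| := by positivity
              linarith

/-! ### The folded sphere and the measure of its balls. -/

/-- The unit sphere with the pseudo-metric `max_i ||x_i| - |y_i||`, which identifies the points that
differ only by signs of their coordinates. -/
def FoldedSphere (d : ℕ) : Type := UnitSphere d

namespace FoldedSphere

variable {d : ℕ}

instance : MeasurableSpace (FoldedSphere d) := inferInstanceAs (MeasurableSpace (UnitSphere d))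

/-- The absolute values of the coordinates. -/
def fold (x : FoldedSphere d) (i : Fin (d + 1)) : ℝ := |x.1 i|

instance : PseudoMetricSpace (FoldedSphere d) := PseudoMetricSpace.induced fold inferInstance

lemma measurable_coord (i : Fin (d + 1)) : Measurable fun x : FoldedSphere d => x.1 i :=
  show Measurable fun x : UnitSphere d => x.1 i by fun_prop

lemma measurable_fold : Measurable (fold : FoldedSphere d → Fin (d + 1) → ℝ) :=
  measurable_pi_lambda _ fun i => (continuous_abs.measurable).comp (measurable_coord i)

lemma isInducing_fold : Topology.IsInducing (fold : FoldedSphere d → Fin (d + 1) → ℝ) := ⟨rfl⟩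

instance : SecondCountableTopology (FoldedSphere d) := isInducing_fold.secondCountableTopology

instance : OpensMeasurableSpace (FoldedSphere d) := by
  refine ⟨MeasurableSpace.generateFrom_le fun s hs => ?_⟩
  obtain ⟨t, ht, rfl⟩ := isInducing_fold.isOpen_iff.1 hs
  exact measurable_fold ht.measurableSet

lemma norm_eq_one (x : FoldedSphere d) : ‖x.1‖ = 1 := mem_sphere_zero_iff_norm.1 x.2

lemma abs_coord_le_one (x : FoldedSphere d) (i : Fin (d + 1)) : |x.1 i| ≤ 1 := by
  have h := PiLp.norm_apply_le x.1 i
  rwa [norm_eq_one, Real.norm_eq_abs] at h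

lemma mem_ball_iff {x y : FoldedSphere d} {r : ℝ} (hr : 0 < r) :
    y ∈ ball x r ↔ ∀ i, abs (|y.1 i| - |x.1 i|) < r := by
  change dist (fold y) (fold x) < r ↔ _
  rw [dist_pi_lt_iff hr]
  rfl

lemma ball_eq_univ {x : FoldedSphere d} {r : ℝ} (hr : 2 ≤ r) : ball x r = univ := by
  refine eq_univ_of_forall fun y => (mem_ball_iff (by linarith)).2 fun i => ?_
  have h1 := abs_coord_le_one x i
  have h2 := abs_coord_le_one y i
  have h3 := abs_nonneg (x.1 i)
  have h4 := abs_nonneg (y.1 i)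
  exact abs_lt.2 ⟨by linarith, by linarith⟩

instance : BoundedSpace (FoldedSphere d) := by
  refine ⟨?_⟩
  rcases isEmpty_or_nonempty (FoldedSphere d) with h | ⟨⟨x⟩⟩
  · rw [univ_eq_empty_iff.2 h]; exact Bornology.isBounded_empty
  · rw [← ball_eq_univ (x := x) le_rfl]; exact isBounded_ball

/-- The measure `h_τ² dω` on the folded sphere. -/
def measure (τ : Fin (d + 1) → ℝ) : Measure (FoldedSphere d) := weightedMeasure τ

/-- The size of the balls of radius `r` with respect to `h_τ² dω`. -/
def ballSize (τ : Fin (d + 1) → ℝ) (x : FoldedSphere d) (r : ℝ) : ℝ :=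
  r ^ d * ∏ i, (|x.1 i| + r) ^ (2 * τ i)

lemma ballSize_pos (τ : Fin (d + 1) → ℝ) (x : FoldedSphere d) {r : ℝ} (hr : 0 < r) :
    0 < ballSize τ x r :=
  mul_pos (by positivity) (Finset.prod_pos fun i _ => by positivity)

/-- The density `h_τ²`. -/
def density (τ : Fin (d + 1) → ℝ) (z : EuclideanSpace ℝ (Fin (d + 1))) : ℝ≥0∞ :=
  ENNReal.ofReal (∏ i, |z i| ^ (2 * τ i))

lemma measurable_density (τ : Fin (d + 1) → ℝ) : Measurable (density τ) := by
  unfold density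
  fun_prop

lemma density_eq (τ : Fin (d + 1) → ℝ) (z : EuclideanSpace ℝ (Fin (d + 1))) :
    ENNReal.ofReal (productWeight τ z ^ 2) = density τ z := by
  rw [productWeight, density, ← Finset.prod_pow]
  congr 1
  refine Finset.prod_congr rfl fun i _ => ?_
  rw [← Real.rpow_natCast, ← Real.rpow_mul (abs_nonneg _), mul_comm]
  norm_num

/-- The surface measure on the folded sphere. -/
def surface (d : ℕ) : Measure (FoldedSphere d) := surfaceMeasure d

instance : IsFiniteMeasure (surface d) :=
  inferInstanceAs (IsFiniteMeasure (volume : Measure (EuclideanSpace ℝ (Fin (d + 1)))).toSphere)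

lemma measure_eq (τ : Fin (d + 1) → ℝ) :
    measure τ = (surface d).withDensity fun x => density τ x.1 := by
  simp only [measure, weightedMeasure, density_eq]
  rfl

/-- The points of the ball around `x` whose coordinates have the same signs as those of `x`. -/
def signedBall (x : FoldedSphere d) (r : ℝ) : Set (FoldedSphere d) :=
  {y | ∀ i, abs (|y.1 i| - |x.1 i|) < r ∧ 0 ≤ x.1 i * y.1 i}

/-- The condition defining the ball, for points of the ambient space. -/
def nearSet (x : FoldedSphere d) (r : ℝ) : Set (EuclideanSpace ℝ (Fin (d + 1))) :=
  {y | ∀ i, abs (|y i| - |x.1 i|) < r}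

/-- The condition defining the signed ball, for points of the ambient space. -/
def signedNearSet (x : FoldedSphere d) (r : ℝ) : Set (EuclideanSpace ℝ (Fin (d + 1))) :=
  {y | ∀ i, abs (|y i| - |x.1 i|) < r ∧ 0 ≤ x.1 i * y i}

lemma measurableSet_nearSet (x : FoldedSphere d) (r : ℝ) : MeasurableSet (nearSet x r) := by
  simp only [nearSet, ofPred_forall]
  exact MeasurableSet.iInter fun i => measurableSet_lt (by fun_prop) (by fun_prop)

lemma measurableSet_signedNearSet (x : FoldedSphere d) (r : ℝ) :
    MeasurableSet (signedNearSet x r) := by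
  simp only [signedNearSet, ofPred_forall, ofPred_and]
  exact MeasurableSet.iInter fun i => (measurableSet_lt (by fun_prop) (by fun_prop)).inter
    (measurableSet_le (by fun_prop) (by fun_prop))

lemma signedBall_subset {x : FoldedSphere d} {r : ℝ} (hr : 0 < r) : signedBall x r ⊆ ball x r :=
  fun _ hy => (mem_ball_iff hr).2 fun i => (hy i).1

/-- The right side integrates over the part of the cone on `s` with `1 < ‖z‖ < 1 + r`. Evaluating
the density at `z/‖z‖` makes the radial integral split off. -/
lemma measure_mul_shell (τ : Fin (d + 1) → ℝ) {s : Set (EuclideanSpace ℝ (Fin (d + 1)))}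
    (hs : MeasurableSet s) (r : ℝ) :
    measure τ {y : FoldedSphere d | y.1 ∈ s} * ∫⁻ t in Ioo 1 (1 + r), ENNReal.ofReal (t ^ d) =
      ∫⁻ z, s.indicator (density τ) (‖z‖⁻¹ • z) * (Ioo 1 (1 + r)).indicator 1 ‖z‖ := by
  rw [lintegral_polar volume ((measurable_density τ).indicator hs)
    (measurable_one.indicator measurableSet_Ioo), volumeIoiPow_shell]
  have hs' : MeasurableSet {y : FoldedSphere d | y.1 ∈ s} :=
    show MeasurableSet {y : UnitSphere d | y.1 ∈ s} from measurable_subtype_coe hs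
  congr 1
  · rw [measure_eq]
    rw [withDensity_apply _ hs', ← lintegral_indicator hs']
    rfl
  · simp

/-- The shell over the ball sits in the product of the windows `||z_i| - |x_i|| < 2r`, where
`|z_i|/‖z‖` and `|z_i|` are comparable as `‖z‖ < 13`. The one-dimensional integrals multiply to
`r^(d+1) ∏ (|x_i|+r)^(2τ_i)`, and dividing by the shell thickness `r` leaves `ballSize`. The bound
`12` on the radius leaves room for `4r` with `r < 2` and for `2θ` with `θ ≤ π`. -/
lemma measure_ball_le {τ : Fin (d + 1) → ℝ} (hτ : ∀ i, -(1 / 2) < τ i) :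
    ∃ C : ℝ, 0 < C ∧ ∀ (x : FoldedSphere d) (r : ℝ), 0 < r → r ≤ 12 →
      measure τ (ball x r) ≤ ENNReal.ofReal (C * ballSize τ x r) := by
  choose C hC0 hC using fun i => exists_lintegral_abs_rpow_le (α := 2 * τ i) (by linarith [hτ i])
  refine ⟨∏ i, (13 ^ |2 * τ i| * C i), Finset.prod_pos fun i _ => mul_pos (by positivity) (hC0 i),
    fun x r hr hr12 => ?_⟩
  set φ : Fin (d + 1) → ℝ → ℝ≥0∞ := fun i => {z : ℝ | abs (|z| - |x.1 i|) < 2 * r}.indicator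
    (fun z => ENNReal.ofReal (|z| ^ (2 * τ i))) with hφ
  have hφm : ∀ i, Measurable (φ i) := fun i =>
    Measurable.indicator (by fun_prop) (measurableSet_lt (by fun_prop) (by fun_prop))
  have hball : ball x r = {y : FoldedSphere d | y.1 ∈ nearSet x r} := by
    ext y; exact mem_ball_iff hr
  have hpt : ∀ z : EuclideanSpace ℝ (Fin (d + 1)),
      (nearSet x r).indicator (density τ) (‖z‖⁻¹ • z) * (Ioo 1 (1 + r)).indicator 1 ‖z‖ ≤
        ∏ i, (ENNReal.ofReal (13 ^ |2 * τ i|) * φ i (z i)) := by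
    intro z
    by_cases hz : ‖z‖ ∈ Ioo 1 (1 + r)
    swap
    · rw [indicator_of_notMem hz, mul_zero]; exact zero_le
    by_cases hy : ‖z‖⁻¹ • z ∈ nearSet x r
    swap
    · rw [indicator_of_notMem hy, zero_mul]; exact zero_le
    rw [indicator_of_mem hz, indicator_of_mem hy, Pi.one_apply, mul_one, density,
      ENNReal.ofReal_prod_of_nonneg fun i _ => by positivity]
    refine Finset.prod_le_prod' fun i _ => ?_
    have hz0 : 0 < ‖z‖ := by linarith [hz.1]
    have hyi : |(‖z‖⁻¹ • z) i| = ‖z‖⁻¹ * |z i| := by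
      rw [PiLp.smul_apply, smul_eq_mul, abs_mul, abs_of_pos (by positivity)]
    have hzle : |z i| ≤ ‖z‖ := by
      rw [← Real.norm_eq_abs]; exact PiLp.norm_apply_le z i
    have hmem : abs (|z i| - |x.1 i|) < 2 * r := by
      have h1 := hy i
      rw [hyi] at h1
      have hle1 : ‖z‖⁻¹ * |z i| ≤ 1 := by
        rw [inv_mul_le_iff₀ hz0, mul_one]; exact hzle
      have hz1 : |z i| = ‖z‖ * (‖z‖⁻¹ * |z i|) := by field_simp
      have hnn : 0 ≤ ‖z‖⁻¹ * |z i| := by positivity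
      obtain ⟨h2, h3⟩ := abs_lt.1 h1
      have := hz.1
      have := hz.2
      rw [abs_lt]
      constructor <;> nlinarith
    have hφi : φ i (z i) = ENNReal.ofReal (|z i| ^ (2 * τ i)) :=
      indicator_of_mem (s := {z : ℝ | abs (|z| - |x.1 i|) < 2 * r}) hmem _
    rw [hφi, hyi, ← ENNReal.ofReal_mul (by positivity)]
    refine ENNReal.ofReal_le_ofReal ?_
    rcases (abs_nonneg (z i)).eq_or_lt with h0 | h0
    · rw [← h0, mul_zero]
      exact le_mul_of_one_le_left (Real.rpow_nonneg le_rfl _)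
        (Real.one_le_rpow (by norm_num) (abs_nonneg _))
    · refine rpow_le_rpow_abs_mul_rpow (by positivity) h0 ?_ ?_
      · rw [inv_mul_le_iff₀ hz0]
        nlinarith [hz.1]
      · rw [← mul_assoc, ← div_eq_mul_inv]
        exact le_mul_of_one_le_left h0.le ((one_le_div hz0).2 (by linarith [hz.2]))
  have hprod : ∫⁻ z : EuclideanSpace ℝ (Fin (d + 1)),
      ∏ i, (ENNReal.ofReal (13 ^ |2 * τ i|) * φ i (z i)) ≤
        ENNReal.ofReal ((∏ i, (13 ^ |2 * τ i| * C i)) * ballSize τ x r * r) := by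
    rw [(PiLp.volume_preserving_ofLp (Fin (d + 1))).lintegral_comp_emb
      (MeasurableEquiv.toLp 2 _).symm.measurableEmbedding
      (fun z => ∏ i, (ENNReal.ofReal (13 ^ |2 * τ i|) * φ i (z i))),
      lintegral_fin_prod (φ := fun i t => ENNReal.ofReal (13 ^ |2 * τ i|) * φ i t)
        (fun i => (hφm i).const_mul _)]
    calc ∏ i, ∫⁻ t, ENNReal.ofReal (13 ^ |2 * τ i|) * φ i t
        ≤ ∏ i, ENNReal.ofReal (13 ^ |2 * τ i| * (C i * (r * (|x.1 i| + r) ^ (2 * τ i)))) := by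
          refine Finset.prod_le_prod' fun i _ => ?_
          rw [lintegral_const_mul _ (hφm i), ENNReal.ofReal_mul (by positivity)]
          gcongr
          exact hC i _ r (abs_nonneg _) hr
      _ = _ := by
          rw [← ENNReal.ofReal_prod_of_nonneg fun i _ => by have := (hC0 i).le; positivity]
          congr 1
          simp only [Finset.prod_mul_distrib, Finset.prod_const, Finset.card_univ, Fintype.card_fin,
            ballSize]
          ring
  have hmain : measure τ (ball x r) * ENNReal.ofReal r ≤
      ENNReal.ofReal ((∏ i, (13 ^ |2 * τ i| * C i)) * ballSize τ x r) * ENNReal.ofReal r := by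
    calc measure τ (ball x r) * ENNReal.ofReal r
        ≤ measure τ (ball x r) * ∫⁻ t in Ioo 1 (1 + r), ENNReal.ofReal (t ^ d) := by
          gcongr; exact le_lintegral_shell d r
      _ ≤ _ := by
          rw [hball, measure_mul_shell τ (measurableSet_nearSet x r)]
          exact lintegral_mono hpt
      _ ≤ _ := hprod
      _ = _ := ENNReal.ofReal_mul (by
          have := (ballSize_pos τ x hr).le
          have : 0 ≤ ∏ i, (13 ^ |2 * τ i| * C i) :=
            Finset.prod_nonneg fun i _ => mul_nonneg (by positivity) (hC0 i).le
          positivity)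
  exact (ENNReal.mul_le_mul_iff_left (by simpa using hr) ENNReal.ofReal_ne_top).1 hmain

/-- Near `(1 + r/2) x` there is a box of side comparable to `r`, in the orthant of `x` and pushed
away from the coordinate hyperplanes, so that `|z_i|` is comparable to `|x_i| + r` on it. It
projects radially into the signed ball, and the integrand is bounded below there for weight
exponents of either sign. -/
lemma le_measure_signedBall (τ : Fin (d + 1) → ℝ) :
    ∃ c : ℝ, 0 < c ∧ ∀ (x : FoldedSphere d) (r : ℝ), 0 < r → r ≤ 12 →
      ENNReal.ofReal (c * ballSize τ x r) ≤ measure τ (signedBall x r) := by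
  -- `104 = 8 · 13`: the factor `8(d+1)` compares `|x_i| + r` with `|x_i| + ρ/2`, and `13` bounds
  -- `‖z‖`.
  set l : ℝ := 104 * (d + 1) with hl
  have hl0 : 0 < l := by positivity
  refine ⟨(∏ i, (l ^ |2 * τ i|)⁻¹) * (8 * ((d : ℝ) + 1))⁻¹ ^ (d + 1) / 13 ^ d,
    div_pos (mul_pos (Finset.prod_pos fun i _ => by positivity) (by positivity)) (by positivity),
    fun x r hr hr12 => ?_⟩
  -- With this `ρ` the box lies within `r/4` of `(1 + r/2) x`, hence inside the shell.
  set ρ : ℝ := r / (4 * (d + 1)) with hρ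
  have hρ0 : 0 < ρ := by positivity
  have hρr : (d + 1) * ρ = r / 4 := by rw [hρ]; field_simp
  have hρr' : ρ ≤ r / 4 := by
    rw [← hρr]; exact le_mul_of_one_le_left hρ0.le (by linarith [Nat.cast_nonneg (α := ℝ) d])
  set a : Fin (d + 1) → ℝ := fun i => (1 + r / 2) * |x.1 i| with ha
  set box : Fin (d + 1) → Set ℝ := fun i =>
    if 0 ≤ x.1 i then Ioo (a i + ρ / 2) (a i + ρ) else Ioo (-(a i + ρ)) (-(a i + ρ / 2)) with hbox
  have ha0 : ∀ i, 0 ≤ a i := fun i => by positivity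
  have hboxm : ∀ i, MeasurableSet (box i) := fun i => by
    rw [hbox]; dsimp only; split_ifs <;> exact measurableSet_Ioo
  have hboxv : ∀ i, volume (box i) = ENNReal.ofReal (ρ / 2) := fun i => by
    rw [hbox]; dsimp only; split_ifs <;> rw [Real.volume_Ioo] <;> congr 1 <;> ring
  have hbox1 : ∀ i, ∀ t ∈ box i, a i + ρ / 2 < |t| ∧ |t| < a i + ρ ∧ 0 ≤ x.1 i * t ∧
      |t - (1 + r / 2) * x.1 i| ≤ ρ := by
    intro i t ht
    have hai := ha0 i
    rw [hbox] at ht; dsimp only at ht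
    split_ifs at ht with h
    · have ht0 : 0 < t := by linarith [ht.1]
      have hax : a i = (1 + r / 2) * x.1 i := by rw [ha]; dsimp only; rw [abs_of_nonneg h]
      rw [abs_of_pos ht0, ← hax]
      exact ⟨ht.1, ht.2, mul_nonneg h ht0.le, abs_le.2 ⟨by linarith [ht.1], by linarith [ht.2]⟩⟩
    · have ht0 : t < 0 := by linarith [ht.2]
      have hax : -a i = (1 + r / 2) * x.1 i := by
        rw [ha]; dsimp only; rw [abs_of_neg (not_le.1 h)]; ring
      rw [abs_of_neg ht0, ← hax]
      exact ⟨by linarith [ht.2], by linarith [ht.1],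
        mul_nonneg_of_nonpos_of_nonpos (not_le.1 h).le ht0.le,
        abs_le.2 ⟨by linarith [ht.1], by linarith [ht.2]⟩⟩
  set K : ℝ := ∏ i, ((l ^ |2 * τ i|)⁻¹ * (|x.1 i| + r) ^ (2 * τ i)) with hK
  have hK0 : 0 ≤ K := Finset.prod_nonneg fun i _ => by positivity
  have hpt : ∀ z : EuclideanSpace ℝ (Fin (d + 1)),
      (univ.pi box).indicator (fun _ => ENNReal.ofReal K) z.ofLp ≤
      (signedNearSet x r).indicator (density τ) (‖z‖⁻¹ • z) *
        (Ioo 1 (1 + r)).indicator 1 ‖z‖ := by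
    intro z
    by_cases hz : z.ofLp ∈ univ.pi box
    swap
    · rw [indicator_of_notMem hz]; exact zero_le
    have hzi := fun i => hbox1 i (z i) (hz i (mem_univ i))
    have hdist : ‖z - (1 + r / 2) • x.1‖ ≤ r / 4 := by
      rw [EuclideanSpace.norm_eq]
      refine Real.sqrt_le_iff.2 ⟨by positivity, ?_⟩
      calc ∑ i, ‖(z - (1 + r / 2) • x.1) i‖ ^ 2 ≤ ∑ i : Fin (d + 1), ρ ^ 2 := by
            refine Finset.sum_le_sum fun i _ => ?_
            gcongr
            exact (hzi i).2.2.2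
        _ = (d + 1) * ρ ^ 2 := by simp
        _ ≤ ((d + 1) * ρ) ^ 2 := by
            rw [mul_pow]
            gcongr
            nlinarith [Nat.cast_nonneg (α := ℝ) d]
        _ = _ := by rw [hρr]
    have hnx : ‖(1 + r / 2) • x.1‖ = 1 + r / 2 := by
      rw [norm_smul, norm_eq_one, mul_one, Real.norm_eq_abs, abs_of_pos (by positivity)]
    have hnz : |‖z‖ - (1 + r / 2)| ≤ r / 4 := by
      rw [← hnx]; exact (abs_norm_sub_norm_le _ _).trans hdist
    obtain ⟨hn1, hn2⟩ := abs_le.1 hnz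
    have hz0 : 0 < ‖z‖ := by linarith
    have hz1 : 1 < ‖z‖ := by linarith
    have hyi : ∀ i, |(‖z‖⁻¹ • z) i| = ‖z‖⁻¹ * |z i| := fun i => by
      rw [PiLp.smul_apply, smul_eq_mul, abs_mul, abs_of_pos (by positivity)]
    have hmem : ‖z‖⁻¹ • z ∈ signedNearSet x r := by
      intro i
      obtain ⟨h1, h2, h3, -⟩ := hzi i
      constructor
      · rw [hyi]
        have hx1 := abs_coord_le_one x i
        have hx0 := abs_nonneg (x.1 i)
        have e : ‖z‖⁻¹ * |z i| - |x.1 i| = ‖z‖⁻¹ * (|z i| - ‖z‖ * |x.1 i|) := by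
          field_simp
        rw [e, abs_mul, abs_of_pos (inv_pos.2 hz0), inv_mul_lt_iff₀ hz0]
        have h5 : abs (|z i| - ‖z‖ * |x.1 i|) < r := by
          rw [abs_lt]
          have ha' : a i = (1 + r / 2) * |x.1 i| := rfl
          constructor <;> nlinarith
        nlinarith
      · rw [PiLp.smul_apply, smul_eq_mul, mul_left_comm]
        exact mul_nonneg (by positivity) h3
    rw [indicator_of_mem hz, indicator_of_mem hmem, indicator_of_mem (show ‖z‖ ∈ Ioo 1 (1 + r) from
      ⟨hz1, by linarith⟩), Pi.one_apply, mul_one, density]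
    refine ENNReal.ofReal_le_ofReal (Finset.prod_le_prod (fun i _ => by positivity) fun i _ => ?_)
    obtain ⟨h1, h2, -, -⟩ := hzi i
    have hx0 := abs_nonneg (x.1 i)
    have ha' : a i = (1 + r / 2) * |x.1 i| := rfl
    have hzpos : 0 < |z i| := by linarith [ha0 i]
    have hd := Nat.cast_nonneg (α := ℝ) d
    have hρ4 : r = 4 * (d + 1) * ρ := by rw [hρ]; field_simp
    rw [hyi, inv_mul_le_iff₀ (by positivity)]
    refine rpow_le_rpow_abs_mul_rpow (by positivity) (by positivity) ?_ ?_
    · rw [← div_eq_inv_mul, mul_div_assoc', le_div_iff₀ hz0]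
      have hz13 : ‖z‖ ≤ 13 := by linarith
      have h6 : |x.1 i| + r ≤ 8 * (d + 1) * (|x.1 i| + ρ / 2) := by nlinarith
      have h7 : |x.1 i| + ρ / 2 ≤ |z i| := by nlinarith
      calc (|x.1 i| + r) * ‖z‖ ≤ (8 * (d + 1) * |z i|) * 13 := by gcongr; exact h6.trans (by gcongr)
        _ = l * |z i| := by rw [hl]; ring
    · rw [inv_mul_le_iff₀ hz0]
      have h8 : |z i| ≤ 7 * (|x.1 i| + r) := by nlinarith
      have h9 : 7 ≤ l := by rw [hl]; linarith
      calc |z i| ≤ 7 * (|x.1 i| + r) := h8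
        _ ≤ l * (|x.1 i| + r) := by gcongr
        _ ≤ ‖z‖ * (l * (|x.1 i| + r)) := le_mul_of_one_le_left (by positivity) hz1.le
  have hint : ENNReal.ofReal (K * (ρ / 2) ^ (d + 1)) ≤ measure τ (signedBall x r) *
      ENNReal.ofReal ((1 + 12) ^ d * r) := by
    calc ENNReal.ofReal (K * (ρ / 2) ^ (d + 1))
        = ∫⁻ z : EuclideanSpace ℝ (Fin (d + 1)),
            (univ.pi box).indicator (fun _ => ENNReal.ofReal K) z.ofLp := by
          rw [(PiLp.volume_preserving_ofLp (Fin (d + 1))).lintegral_comp_emb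
            (MeasurableEquiv.toLp 2 _).symm.measurableEmbedding
            ((univ.pi box).indicator fun _ => ENNReal.ofReal K),
            lintegral_indicator (MeasurableSet.univ_pi hboxm), setLIntegral_const, volume_pi_pi]
          simp only [hboxv, Finset.prod_const, Finset.card_univ, Fintype.card_fin]
          rw [ENNReal.ofReal_mul hK0, ENNReal.ofReal_pow (by positivity)]
      _ ≤ _ := lintegral_mono hpt
      _ = measure τ (signedBall x r) * ∫⁻ t in Ioo 1 (1 + r), ENNReal.ofReal (t ^ d) :=
          (measure_mul_shell τ (measurableSet_signedNearSet x r) r).symm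
      _ ≤ _ := by gcongr; exact lintegral_shell_le d hr12 hr.le
  have hpos : (0 : ℝ) < (1 + 12) ^ d * r := by positivity
  refine (ENNReal.mul_le_mul_iff_left (by simpa using hpos) ENNReal.ofReal_ne_top).1
    (le_trans (le_of_eq ?_) hint)
  have hB := (ballSize_pos τ x hr).le
  rw [← ENNReal.ofReal_mul' hpos.le]
  congr 1
  have h13 : (1 + 12 : ℝ) = 13 := by norm_num
  have hρ8 : ρ / 2 = (8 * ((d : ℝ) + 1))⁻¹ * r := by rw [hρ]; field_simp; norm_num
  rw [hK, hρ8, ballSize, Finset.prod_mul_distrib, h13, mul_pow _ r]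
  field_simp
  ring

end FoldedSphere

/-! ### Doubling, Muckenhoupt weights and the weighted inequalities on the folded sphere. -/

namespace FoldedSphere

variable {d : ℕ}

lemma ballSize_mul_le (τ : Fin (d + 1) → ℝ) {l : ℝ} (hl : 1 ≤ l) (x : FoldedSphere d) {r : ℝ}
    (hr : 0 < r) :
    ballSize τ x (l * r) ≤ (l ^ d * ∏ i, l ^ |2 * τ i|) * ballSize τ x r := by
  have h : ∏ i, (|x.1 i| + l * r) ^ (2 * τ i) ≤
      (∏ i, l ^ |2 * τ i|) * ∏ i, (|x.1 i| + r) ^ (2 * τ i) := by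
    rw [← Finset.prod_mul_distrib]
    refine Finset.prod_le_prod (fun i _ => by positivity) fun i _ => ?_
    have hx := abs_nonneg (x.1 i)
    have h1 : r ≤ l * r := le_mul_of_one_le_left hr.le hl
    refine rpow_le_rpow_abs_mul_rpow (by positivity) (by positivity) (by nlinarith) ?_
    exact (by linarith : |x.1 i| + r ≤ |x.1 i| + l * r).trans
      (le_mul_of_one_le_left (by positivity) hl)
  rw [ballSize, ballSize, mul_pow]
  calc l ^ d * r ^ d * ∏ i, (|x.1 i| + l * r) ^ (2 * τ i)
      ≤ l ^ d * r ^ d * ((∏ i, l ^ |2 * τ i|) * ∏ i, (|x.1 i| + r) ^ (2 * τ i)) := by gcongr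
    _ = _ := by ring

/-- Both measures are comparable to `ballSize`. Having a single orthant on the right gives more than
doubling: it is what bounds the denominator of `intertwiningMaximal` from below. -/
lemma measure_ball_mul_le {τ : Fin (d + 1) → ℝ} (hτ : ∀ i, -(1 / 2) < τ i) {l : ℝ} (hl : 1 ≤ l) :
    ∃ C : ℝ≥0, ∀ (x : FoldedSphere d) (r : ℝ), 0 < r → l * r ≤ 12 →
      measure τ (ball x (l * r)) ≤ C * measure τ (signedBall x r) := by
  obtain ⟨C, hC0, hC⟩ := measure_ball_le hτ
  obtain ⟨c, hc0, hc⟩ := le_measure_signedBall τ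
  set K := l ^ d * ∏ i, l ^ |2 * τ i| with hK
  have hK0 : 0 ≤ K := by positivity
  refine ⟨(C * K / c).toNNReal, fun x r hr hlr => ?_⟩
  have hr12 : r ≤ 12 := by nlinarith
  have hB := ballSize_pos τ x hr
  calc measure τ (ball x (l * r)) ≤ ENNReal.ofReal (C * ballSize τ x (l * r)) :=
        hC x _ (by positivity) hlr
    _ ≤ ENNReal.ofReal (C * K / c * (c * ballSize τ x r)) := by
        refine ENNReal.ofReal_le_ofReal ?_
        calc C * ballSize τ x (l * r) ≤ C * (K * ballSize τ x r) := by
              gcongr; exact ballSize_mul_le τ hl x hr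
          _ = _ := by field_simp
    _ = ENNReal.ofReal (C * K / c) * ENNReal.ofReal (c * ballSize τ x r) :=
        ENNReal.ofReal_mul (by positivity)
    _ ≤ _ := by
        rw [ENNReal.ofReal]
        gcongr
        exact hc x r hr hr12

lemma isFiniteMeasure_measure {τ : Fin (d + 1) → ℝ} (hτ : ∀ i, -(1 / 2) < τ i) :
    IsFiniteMeasure (measure τ) := by
  obtain ⟨C, hC0, hC⟩ := measure_ball_le hτ
  refine ⟨?_⟩
  rcases isEmpty_or_nonempty (FoldedSphere d) with h | ⟨⟨x⟩⟩
  · rw [univ_eq_empty_iff.2 h]; simp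
  · rw [← ball_eq_univ (x := x) le_rfl]
    exact (hC x 2 (by norm_num) (by norm_num)).trans_lt ENNReal.ofReal_lt_top

lemma exists_isDoublingOn {τ : Fin (d + 1) → ℝ} (hτ : ∀ i, -(1 / 2) < τ i) :
    ∃ D : ℝ≥0, IsDoublingOn (measure τ) D := by
  have := isFiniteMeasure_measure hτ
  obtain ⟨c, hc0, hc⟩ := le_measure_signedBall τ
  obtain ⟨C, hC⟩ := measure_ball_mul_le hτ (l := 4) (by norm_num)
  refine ⟨C + 1, fun x r hr => ?_, fun x r => measure_lt_top _ _, fun x r hr => ?_⟩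
  · have hm : 0 < min r 2 := lt_min hr two_pos
    refine lt_of_lt_of_le ?_ (((hc x (min r 2) hm (by linarith [min_le_right r 2])).trans
      (measure_mono (signedBall_subset hm))).trans
      (measure_mono (ball_subset_ball (min_le_left _ _))))
    exact ENNReal.ofReal_pos.2 (mul_pos hc0 (ballSize_pos τ x hm))
  -- For `r ≥ 2` both balls are the whole sphere, and the `+ 1` makes the constant at least `1`.
  · rcases le_or_gt 2 r with h2 | h2
    · rw [ball_eq_univ h2, ball_eq_univ (by linarith)]
      exact le_mul_of_one_le_left zero_le (by simp)
    · calc measure τ (ball x (4 * r)) ≤ C * measure τ (signedBall x r) :=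
            hC x r hr (by linarith)
        _ ≤ _ := by
          gcongr
          · simp
          · exact signedBall_subset hr

/-- The cone over `{x_i = 0}` lies in a hyperplane, a null set. Off these hyperplanes the densities
are positive and finite, so their powers may be multiplied freely. -/
lemma ae_coord_ne_zero : ∀ᵐ x ∂(surface d), ∀ i, x.1 i ≠ 0 := by
  rw [ae_all_iff]
  intro i
  set s : Set (EuclideanSpace ℝ (Fin (d + 1))) := {z | z i = 0} with hs
  have hsm : MeasurableSet s := measurableSet_eq_fun (by fun_prop) (by fun_prop)
  have h0 : (surface d) {y : FoldedSphere d | y.1 ∈ s} *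
      ∫⁻ t in Ioo 1 (1 + (1 : ℝ)), ENNReal.ofReal (t ^ d) = 0 := by
    have h := measure_mul_shell (d := d) 0 hsm 1
    have e : measure (d := d) 0 = surface d := by
      rw [measure_eq]
      simp [density]
    rw [e] at h
    rw [h]
    have hv : volume s = 0 := by
      have := (PiLp.volume_preserving_ofLp (Fin (d + 1))).measure_preimage
        (s := {f : Fin (d + 1) → ℝ | f i = 0})
        (measurableSet_eq_fun (by fun_prop) (by fun_prop)).nullMeasurableSet
      rw [volume_pi, Measure.pi_hyperplane] at this
      exact this
    refine lintegral_eq_zero_of_ae_eq_zero ?_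
    filter_upwards [measure_eq_zero_iff_ae_notMem.1 hv] with z hz
    by_cases hz1 : ‖z‖ ∈ Ioo (1 : ℝ) (1 + 1)
    · have : ‖z‖⁻¹ • z ∉ s := by
        intro hmem
        have hz0 : (0 : ℝ) < ‖z‖ := by linarith [hz1.1]
        have : ‖z‖⁻¹ * z i = 0 := hmem
        exact hz ((mul_eq_zero.1 this).resolve_left (by positivity))
      simp [indicator_of_notMem this]
    · simp [indicator_of_notMem hz1]
  have h1 : ∫⁻ t in Ioo 1 (1 + (1 : ℝ)), ENNReal.ofReal (t ^ d) ≠ 0 :=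
    ((ENNReal.ofReal_pos.2 one_pos).trans_le (le_lintegral_shell d 1)).ne'
  have h2 := (mul_eq_zero.1 h0).resolve_right h1
  exact measure_eq_zero_iff_ae_notMem.1 h2

lemma density_ne_zero {α : Fin (d + 1) → ℝ} {z : EuclideanSpace ℝ (Fin (d + 1))}
    (hz : ∀ i, z i ≠ 0) : density α z ≠ 0 := by
  refine (ENNReal.ofReal_pos.2 (Finset.prod_pos fun i _ => ?_)).ne'
  have := abs_pos.2 (hz i)
  positivity

lemma density_add {α β : Fin (d + 1) → ℝ} {z : EuclideanSpace ℝ (Fin (d + 1))}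
    (hz : ∀ i, z i ≠ 0) : density (α + β) z = density α z * density β z := by
  rw [density, density, density, ← ENNReal.ofReal_mul (Finset.prod_nonneg fun i _ => by positivity),
    ← Finset.prod_mul_distrib]
  congr 1
  refine Finset.prod_congr rfl fun i _ => ?_
  rw [← Real.rpow_add (abs_pos.2 (hz i)), Pi.add_apply, mul_add]

lemma density_smul {α : Fin (d + 1) → ℝ} {z : EuclideanSpace ℝ (Fin (d + 1))}
    (hz : ∀ i, z i ≠ 0) (t : ℝ) : density (t • α) z = density α z ^ t := by
  have hpos : 0 < ∏ i, |z i| ^ (2 * α i) := Finset.prod_pos fun i _ => by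
    have := abs_pos.2 (hz i)
    positivity
  rw [density, density, ENNReal.ofReal_rpow_of_pos hpos,
    ← Real.finsetProd_rpow _ _ (fun i _ => by positivity)]
  congr 1
  refine Finset.prod_congr rfl fun i _ => ?_
  rw [← Real.rpow_mul (abs_nonneg _), Pi.smul_apply, smul_eq_mul]
  congr 1; ring

lemma measurable_density_val (α : Fin (d + 1) → ℝ) :
    Measurable fun x : FoldedSphere d => density α x.1 :=
  show Measurable fun x : UnitSphere d => density α x.1 from
    (measurable_density α).comp measurable_subtype_coe

lemma withDensity_measure (κ α : Fin (d + 1) → ℝ) :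
    (measure κ).withDensity (fun x => density α x.1) = measure (κ + α) := by
  rw [measure_eq, measure_eq, ← withDensity_mul _ (measurable_density_val κ)
    (measurable_density_val α)]
  refine withDensity_congr_ae ?_
  filter_upwards [ae_coord_ne_zero] with x hx
  exact (density_add hx).symm

lemma measure_absolutelyContinuous (κ : Fin (d + 1) → ℝ) : measure κ ≪ surface d := by
  rw [measure_eq]; exact withDensity_absolutelyContinuous _ _

lemma lintegral_density_mul (κ α : Fin (d + 1) → ℝ) {g : FoldedSphere d → ℝ≥0∞}
    (hg : Measurable g) (t : ℝ) :
    ∫⁻ x, g x * density α x.1 ^ t ∂(measure κ) = ∫⁻ x, g x ∂(measure (κ + t • α)) := by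
  rw [← withDensity_measure, lintegral_withDensity_eq_lintegral_mul _ (measurable_density_val _) hg]
  refine lintegral_congr_ae ?_
  filter_upwards [(measure_absolutelyContinuous κ).ae_le ae_coord_ne_zero] with x hx
  rw [Pi.mul_apply, density_smul hx, mul_comm]

lemma ballSize_rpow (τ : Fin (d + 1) → ℝ) (x : FoldedSphere d) {r : ℝ} (hr : 0 < r) (t : ℝ) :
    ballSize τ x r ^ t = r ^ (d * t) * ∏ i, (|x.1 i| + r) ^ (2 * τ i * t) := by
  rw [ballSize, Real.mul_rpow (by positivity) (Finset.prod_nonneg fun i _ => by positivity),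
    ← Real.finsetProd_rpow _ _ (fun i _ => by positivity), ← Real.rpow_natCast,
    ← Real.rpow_mul hr.le]
  congr 1
  refine Finset.prod_congr rfl fun i _ => ?_
  rw [← Real.rpow_mul (by positivity)]

/-- The Muckenhoupt condition for the power weights. -/
lemma muckenhoupt {κ τ σ : Fin (d + 1) → ℝ} (hτ : ∀ i, -(1 / 2) < τ i)
    (hσ : ∀ i, -(1 / 2) < σ i) {a b : ℝ} (ha : 0 < a) (hb : 0 < b) (hab : a + b = 1)
    (hκ : ∀ i, κ i = a * τ i + b * σ i) :
    ∃ K : ℝ≥0, ∀ (x : FoldedSphere d) (r : ℝ), 0 < r →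
      measure τ (ball x r) ^ a * measure σ (ball x r) ^ b ≤ K * measure κ (ball x r) := by
  obtain ⟨C₁, hC₁, h₁⟩ := measure_ball_le hτ
  obtain ⟨C₂, hC₂, h₂⟩ := measure_ball_le hσ
  obtain ⟨c, hc0, hc⟩ := le_measure_signedBall κ
  have hsmall : ∀ (x : FoldedSphere d) (r : ℝ), 0 < r → r ≤ 12 →
      measure τ (ball x r) ^ a * measure σ (ball x r) ^ b ≤
        (C₁ ^ a * C₂ ^ b / c).toNNReal * measure κ (ball x r) := by
    intro x r hr hr12
    have hB₁ := ballSize_pos τ x hr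
    have hB₂ := ballSize_pos σ x hr
    -- As `κ = a τ + b σ` and `a + b = 1`, the ball sizes multiply exactly, with no loss.
    have hprod : ballSize τ x r ^ a * ballSize σ x r ^ b = ballSize κ x r := by
      rw [ballSize_rpow τ x hr, ballSize_rpow σ x hr, mul_mul_mul_comm, ← Real.rpow_add hr,
        ← mul_add, hab, mul_one, Real.rpow_natCast, ← Finset.prod_mul_distrib, ballSize]
      congr 1
      refine Finset.prod_congr rfl fun i _ => ?_
      rw [← Real.rpow_add (by positivity), hκ i]
      congr 1; ring
    calc measure τ (ball x r) ^ a * measure σ (ball x r) ^ b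
        ≤ ENNReal.ofReal (C₁ * ballSize τ x r) ^ a * ENNReal.ofReal (C₂ * ballSize σ x r) ^ b := by
          gcongr
          · exact h₁ x r hr hr12
          · exact h₂ x r hr hr12
      _ = ENNReal.ofReal (C₁ ^ a * C₂ ^ b / c) * ENNReal.ofReal (c * ballSize κ x r) := by
          rw [ENNReal.ofReal_rpow_of_pos (by positivity), ENNReal.ofReal_rpow_of_pos (by positivity),
            ← ENNReal.ofReal_mul (by positivity), ← ENNReal.ofReal_mul (by positivity), ← hprod,
            Real.mul_rpow hC₁.le hB₁.le, Real.mul_rpow hC₂.le hB₂.le]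
          congr 1
          field_simp
      _ ≤ _ := by
          rw [ENNReal.ofReal]
          gcongr
          exact (hc x r hr hr12).trans (measure_mono (signedBall_subset hr))
  refine ⟨(C₁ ^ a * C₂ ^ b / c).toNNReal, fun x r hr => ?_⟩
  rcases le_or_gt r 12 with h | h
  · exact hsmall x r hr h
  · have := hsmall x 12 (by norm_num) le_rfl
    rwa [ball_eq_univ (by norm_num), ← ball_eq_univ (x := x) (r := r) (by linarith)] at this

/-- Hölder on a ball against the weight `h_(τ-κ)²` produces the dual measure `h_σ² dω` with `σ = (rκ
- τ)/(r - 1)`. The upper bound on `τ` says exactly that `σ > -1/2`, and the Muckenhoupt condition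
converts the product of norms into an average for `h_τ² dω`. -/
lemma maximalFn_le_rpow {κ τ : Fin (d + 1) → ℝ} {r : ℝ} (hr : 1 < r)
    (hτ : ∀ i, -(1 / 2) < τ i ∧ τ i < r * κ i + (r - 1) / 2) :
    ∃ K : ℝ≥0, ∀ g : FoldedSphere d → ℝ≥0∞, Measurable g → ∀ x,
      maximalFn (measure κ) g x ≤ K * maximalFn (measure τ) (fun y => g y ^ r) x ^ (1 / r) := by
  have hr1 : 0 < r - 1 := by linarith
  have hr0 : 0 < r := by linarith
  set r' := r / (r - 1) with hr'
  have hr'0 : 0 < r' := by positivity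
  have hconj : r.HolderConjugate r' := Real.HolderConjugate.conjExponent hr
  set σ : Fin (d + 1) → ℝ := κ + (-(1 / (r - 1))) • (τ - κ) with hσ
  have hσ0 : ∀ i, -(1 / 2) < σ i := by
    intro i
    have h := (hτ i).2
    have e : σ i = (r * κ i - τ i) / (r - 1) := by
      simp only [hσ, Pi.add_apply, Pi.smul_apply, Pi.sub_apply, smul_eq_mul]
      field_simp; ring
    rw [e, lt_div_iff₀ hr1]
    linarith
  have hκσ : ∀ i, κ i = 1 / r * τ i + 1 / r' * σ i := by
    intro i
    simp only [hσ, Pi.add_apply, Pi.smul_apply, Pi.sub_apply, smul_eq_mul, hr']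
    field_simp
    ring
  have hab : 1 / r + 1 / r' = 1 := by
    rw [one_div, one_div]; exact hconj.inv_add_inv_eq_one
  obtain ⟨K, hK⟩ := muckenhoupt (d := d) (fun i => (hτ i).1) hσ0 (by positivity) (by positivity)
    hab hκσ
  obtain ⟨Dτ, hDτ⟩ := exists_isDoublingOn (fun i => (hτ i).1)
  refine ⟨K, fun g hg x => maximalFn_le fun z ρ hx => ?_⟩
  have hρ : 0 < ρ := pos_of_mem_ball hx
  set B := ball z ρ with hB
  have hBm : MeasurableSet B := measurableSet_ball
  set w : FoldedSphere d → ℝ≥0∞ := fun x => density (τ - κ) x.1 with hw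
  have hwm : Measurable w := measurable_density_val _
  have hH : ∫⁻ y in B, g y ∂(measure κ) ≤
      (∫⁻ y in B, g y ^ r ∂(measure τ)) ^ (1 / r) * measure σ B ^ (1 / r') := by
    calc ∫⁻ y in B, g y ∂(measure κ)
        ≤ ∫⁻ y in B, (g y * w y ^ (1 / r)) * w y ^ (-(1 / r)) ∂(measure κ) := by
          refine lintegral_mono_ae (ae_restrict_of_ae ?_)
          filter_upwards [(measure_absolutelyContinuous κ).ae_le ae_coord_ne_zero] with y hy
          rw [mul_assoc, ← ENNReal.rpow_add _ _ (density_ne_zero hy) ENNReal.ofReal_ne_top]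
          simp
      _ ≤ _ := ENNReal.lintegral_mul_le_Lp_mul_Lq _ hconj (by fun_prop) (by fun_prop)
      _ = _ := by
          congr 2
          · have e : ∀ y, (g y * w y ^ (1 / r)) ^ r = g y ^ r * w y ^ (1 : ℝ) := fun y => by
              rw [ENNReal.mul_rpow_of_nonneg _ _ hr0.le, ← ENNReal.rpow_mul,
                one_div_mul_cancel hr0.ne']
            simp only [e]
            have := lintegral_density_mul κ (τ - κ) ((hg.pow_const r).indicator hBm) 1
            rw [one_smul, add_sub_cancel, lintegral_indicator hBm] at this
            rw [← this, ← lintegral_indicator hBm]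
            refine lintegral_congr fun y => ?_
            by_cases hy : y ∈ B <;> simp [hy, hw]
          · have e : ∀ y, (w y ^ (-(1 / r))) ^ r' = w y ^ (-(1 / (r - 1))) := fun y => by
              rw [← ENNReal.rpow_mul]
              congr 1
              rw [hr']; field_simp
            simp only [e]
            have := lintegral_density_mul κ (τ - κ) (measurable_one.indicator hBm)
              (-(1 / (r - 1)))
            rw [← hσ, lintegral_indicator_one hBm] at this
            rw [← this, ← lintegral_indicator hBm]
            refine lintegral_congr fun y => ?_
            by_cases hy : y ∈ B <;> simp [hy, hw]
  have hτ0 : measure τ B ^ (1 / r) ≠ 0 := by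
    simp [hB, ENNReal.rpow_eq_zero_iff, (hDτ.ball_pos z ρ hρ).ne', (hDτ.ball_lt_top z ρ).ne]
  have hτt : measure τ B ^ (1 / r) ≠ ∞ :=
    ENNReal.rpow_ne_top_of_nonneg (by positivity) (hDτ.ball_lt_top z ρ).ne
  refine le_trans ?_ (mul_le_mul_right (ENNReal.rpow_le_rpow (le_maximalFn hx) (by positivity)) _)
  rw [ENNReal.div_rpow_of_nonneg _ _ (by positivity)]
  refine ENNReal.div_le_of_le_mul ?_
  have e : K * ((∫⁻ y in B, g y ^ r ∂(measure τ)) ^ (1 / r) / measure τ B ^ (1 / r)) *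
      measure κ B = (∫⁻ y in B, g y ^ r ∂(measure τ)) ^ (1 / r) * (K * measure κ B) /
      measure τ B ^ (1 / r) := by
    simp only [div_eq_mul_inv]; ring
  rw [e, ENNReal.le_div_iff_mul_le (Or.inl hτ0) (Or.inl hτt)]
  calc (∫⁻ y in B, g y ∂(measure κ)) * measure τ B ^ (1 / r)
      ≤ (∫⁻ y in B, g y ^ r ∂(measure τ)) ^ (1 / r) * measure σ B ^ (1 / r') *
          measure τ B ^ (1 / r) := by gcongr
    _ = (∫⁻ y in B, g y ^ r ∂(measure τ)) ^ (1 / r) *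
          (measure τ B ^ (1 / r) * measure σ B ^ (1 / r')) := by ring
    _ ≤ (∫⁻ y in B, g y ^ r ∂(measure τ)) ^ (1 / r) * (K * measure κ B) := by
        exact mul_le_mul_right (hK z ρ hρ) _

/-- The maximal function is bounded on `L^s(h_τ²)` for the power weights in the Muckenhoupt class. -/
lemma maximalFn_strong_type {κ τ : Fin (d + 1) → ℝ} {s : ℝ} (hs : 1 < s)
    (hτ : ∀ i, -(1 / 2) < τ i ∧ τ i < s * κ i + (s - 1) / 2) :
    ∃ A : ℝ≥0, ∀ g : FoldedSphere d → ℝ≥0∞, Measurable g →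
      ∫⁻ x, maximalFn (measure κ) g x ^ s ∂(measure τ) ≤ A * ∫⁻ x, g x ^ s ∂(measure τ) := by
  -- The strict bound on `τ` survives a small decrease of the exponent; the gap `r < s` leaves the
  -- exponent `s/r > 1` for `M_τ`.
  obtain ⟨r, hr1, hrs, hr⟩ : ∃ r, 1 < r ∧ r < s ∧ ∀ i, τ i < r * κ i + (r - 1) / 2 := by
    have h1 : ∀ᶠ r in nhdsWithin s (Iio s), ∀ i, τ i < r * κ i + (r - 1) / 2 := by
      refine Filter.eventually_all.2 fun i => nhdsWithin_le_nhds ?_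
      have hc : Continuous fun r : ℝ => r * κ i + (r - 1) / 2 := by fun_prop
      exact hc.continuousAt.eventually (lt_mem_nhds (hτ i).2)
    have h2 : ∀ᶠ r in nhdsWithin s (Iio s), 1 < r := nhdsWithin_le_nhds (lt_mem_nhds hs)
    obtain ⟨r, h, h', h''⟩ := (h1.and (h2.and self_mem_nhdsWithin)).exists
    exact ⟨r, h', h'', h⟩
  have hr0 : 0 < r := by linarith
  have hs0 : 0 < s := by linarith
  obtain ⟨K, hK⟩ := maximalFn_le_rpow (d := d) hr1 (fun i => ⟨(hτ i).1, hr i⟩)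
  obtain ⟨D, hD⟩ := exists_isDoublingOn (fun i => (hτ i).1)
  have := isFiniteMeasure_measure (fun i => (hτ i).1)
  obtain ⟨C, hC⟩ := hD.fefferman_stein ((one_lt_div hr0).2 hrs)
  refine ⟨K ^ s * C, fun g hg => ?_⟩
  have hrs' : r * (s / r) = s := mul_div_cancel₀ _ hr0.ne'
  calc ∫⁻ x, maximalFn (measure κ) g x ^ s ∂(measure τ)
      ≤ ∫⁻ x, (K : ℝ≥0∞) ^ s *
          (maximalFn (measure τ) (fun y => g y ^ r) x ^ (s / r) * 1) ∂(measure τ) := by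
        refine lintegral_mono fun x => ?_
        refine (ENNReal.rpow_le_rpow (hK g hg x) hs0.le).trans (le_of_eq ?_)
        rw [ENNReal.mul_rpow_of_nonneg _ _ hs0.le, ← ENNReal.rpow_mul, mul_one]
        congr 2; ring
    _ = (K : ℝ≥0∞) ^ s * ∫⁻ x,
          maximalFn (measure τ) (fun y => g y ^ r) x ^ (s / r) * 1 ∂(measure τ) :=
        lintegral_const_mul' _ _ (by finiteness)
    _ ≤ (K : ℝ≥0∞) ^ s * (C * ∫⁻ x, (g x ^ r) ^ (s / r) *
          maximalFn (measure τ) (fun _ => 1) x ∂(measure τ)) := by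
        gcongr
        exact hC _ (fun _ => 1) (hg.pow_const r) measurable_const
    _ ≤ (K : ℝ≥0∞) ^ s * (C * ∫⁻ x, g x ^ s ∂(measure τ)) := by
        gcongr with x
        rw [← ENNReal.rpow_mul, hrs']
        exact mul_le_of_le_one_right' (maximalFn_const_le 1 x)
    _ = _ := by rw [ENNReal.coe_mul, ENNReal.coe_rpow_of_nonneg _ hs0.le, mul_assoc]

/-- The weighted Fefferman–Stein inequality for the maximal function on the folded sphere. -/
theorem maximalFn_vector_valued {κ τ : Fin (d + 1) → ℝ} {p : ℝ} (hp : 1 < p)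
    (hκ : ∀ i, 0 ≤ κ i) (hτ : ∀ i, -(1 / 2) < τ i ∧ τ i < p * κ i + (p - 1) / 2) :
    ∃ C : ℝ≥0, ∀ f : ℕ → FoldedSphere d → ℝ≥0∞, (∀ j, Measurable (f j)) →
      ∫⁻ x, (∑' j, maximalFn (measure κ) (f j) x ^ (2 : ℝ)) ^ (p / 2) ∂(measure τ) ≤
        C * ∫⁻ x, (∑' j, f j x ^ (2 : ℝ)) ^ (p / 2) ∂(measure τ) := by
  -- At `q = 1` the last inequality is the hypothesis on `τ`, so it persists for `q` slightly above
  -- `1`. It amounts to the dual exponent being greater than `-1/2`.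
  obtain ⟨q, hq1, hq2, hqp, hq⟩ : ∃ q, 1 < q ∧ q < 2 ∧ q < p ∧
      ∀ i, q * τ i < p * κ i + (p - q) / 2 := by
    have h1 : ∀ᶠ q in nhdsWithin (1 : ℝ) (Ioi 1), ∀ i, q * τ i < p * κ i + (p - q) / 2 := by
      refine Filter.eventually_all.2 fun i => nhdsWithin_le_nhds ?_
      have hc : Continuous fun q : ℝ => p * κ i + (p - q) / 2 - q * τ i := by fun_prop
      have := hc.continuousAt.eventually
        (lt_mem_nhds (show 0 < p * κ i + (p - 1) / 2 - 1 * τ i by linarith [(hτ i).2]))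
      filter_upwards [this] with q hq
      linarith
    have h2 : ∀ᶠ q in nhdsWithin (1 : ℝ) (Ioi 1), q < 2 :=
      nhdsWithin_le_nhds (gt_mem_nhds one_lt_two)
    have h3 : ∀ᶠ q in nhdsWithin (1 : ℝ) (Ioi 1), q < p := nhdsWithin_le_nhds (gt_mem_nhds hp)
    obtain ⟨q, h, h', h'', h'''⟩ := (h1.and (h2.and (h3.and self_mem_nhdsWithin))).exists
    exact ⟨q, h''', h', h'', h⟩
  have hq0 : 0 < q := by linarith
  have hpq : 0 < p - q := by linarith
  set P := p / q with hP
  have hP1 : 1 < P := (one_lt_div hq0).2 hqp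
  set s := P.conjExponent with hs
  have hPs : P.HolderConjugate s := Real.HolderConjugate.conjExponent hP1
  have hs1 : 1 < s := hPs.symm.lt
  have hse : s = p / (p - q) := by
    rw [hs, Real.conjExponent, hP]; field_simp
  have hκ0 : ∀ i, -(1 / 2) < κ i := fun i => by linarith [hκ i]
  -- The dual weight has exponent `sκ - (s-1)τ`: its lower bound comes from the choice of `q`, its
  -- upper bound from `τ > -1/2`.
  obtain ⟨A, hA⟩ := maximalFn_strong_type (d := d) (κ := κ) (τ := κ + (1 - s) • (τ - κ)) hs1 (by
    intro i
    have e : (κ + (1 - s) • (τ - κ)) i = s * κ i - (s - 1) * τ i := by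
      simp only [Pi.add_apply, Pi.smul_apply, Pi.sub_apply, smul_eq_mul]; ring
    rw [e]
    constructor
    · have e2 : s * κ i - (s - 1) * τ i = (p * κ i - q * τ i) / (p - q) := by
        rw [hse]; field_simp; ring
      rw [e2, lt_div_iff₀ hpq]
      linarith [hq i]
    · have : 0 < s - 1 := by linarith
      nlinarith [(hτ i).1])
  obtain ⟨D, hD⟩ := exists_isDoublingOn hκ0
  have := isFiniteMeasure_measure hκ0
  have hfin := isFiniteMeasure_measure (fun i => (hτ i).1)
  have hτκ : (measure κ).withDensity (fun x => density (τ - κ) x.1) = measure τ := by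
    rw [withDensity_measure, add_sub_cancel]
  rw [← hτκ] at hfin
  have hw0 : ∀ᵐ x ∂(measure κ), density (τ - κ) x.1 ≠ 0 ∧ density (τ - κ) x.1 ≠ ∞ := by
    filter_upwards [(measure_absolutelyContinuous κ).ae_le ae_coord_ne_zero] with x hx
    exact ⟨density_ne_zero hx, ENNReal.ofReal_ne_top⟩
  obtain ⟨C, hC⟩ := hD.vector_valued_of_dual (measurable_density_val (τ - κ)) hw0 hq1 hPs (A := A)
    (fun g hg => by
      rw [lintegral_density_mul κ (τ - κ) ((measurable_maximalFn g).pow_const s),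
        lintegral_density_mul κ (τ - κ) (hg.pow_const s)]
      exact hA g hg)
  have hac : measure κ ≪ measure τ := by
    rw [← hτκ]
    exact withDensity_absolutelyContinuous' (measurable_density_val _).aemeasurable
      (hw0.mono fun x hx => hx.1)
  rw [hτκ] at hC
  refine ⟨C + 1, fun f hf => ?_⟩
  rw [ENNReal.coe_add, ENNReal.coe_one]
  exact maximalFn_vector_valued_mono hq0 hq2 (by linarith) hac hC hf

end FoldedSphere

/-! ### Mass of the one-dimensional intertwining measure near the endpoints. -/

section IntertwiningMeasure

/-- The extra factor `1 + t` leaves `(1-t)^(k-1)` as the only possible singularity, so for `k > 0`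
the mass within `δ ≤ 1` of `1` has order `δ^k`. -/
lemma intertwining_density_eq {k t : ℝ} (h1 : -1 < t) (h2 : t < 1) :
    (1 + t) * (1 - t ^ 2) ^ (k - 1) = (1 + t) ^ k * (1 - t) ^ (k - 1) := by
  have ht1 : 0 < 1 + t := by linarith
  have e : 1 - t ^ 2 = (1 + t) * (1 - t) := by ring
  rw [e, Real.mul_rpow ht1.le (by linarith), ← mul_assoc, Real.rpow_sub_one ht1.ne',
    mul_div_cancel₀ _ ht1.ne']

lemma lintegral_one_sub_rpow {k δ : ℝ} (hk : 0 < k) (hδ : 0 ≤ δ) :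
    ∫⁻ t in Ioo (1 - δ) 1, ENNReal.ofReal ((1 - t) ^ (k - 1)) = ENNReal.ofReal (δ ^ k / k) := by
  rw [← lintegral_Ioo_rpow hδ hk, ← lintegral_indicator measurableSet_Ioo,
    ← lintegral_indicator measurableSet_Ioo,
    ← lintegral_sub_left_eq_self ((Ioo 0 δ).indicator fun t => ENNReal.ofReal (t ^ (k - 1))) 1]
  refine lintegral_congr fun t => ?_
  have : t ∈ Ioo (1 - δ) 1 ↔ 1 - t ∈ Ioo 0 δ := by
    simp only [mem_Ioo]; constructor <;> intro h <;> constructor <;> linarith [h.1, h.2]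
  by_cases h : t ∈ Ioo (1 - δ) 1
  · rw [indicator_of_mem h, indicator_of_mem (this.1 h)]
  · rw [indicator_of_notMem h, indicator_of_notMem (fun h' => h (this.2 h'))]

lemma intertwiningDensityMeasure_apply (k : ℝ) {s : Set ℝ} (hs : MeasurableSet s) :
    intertwiningDensityMeasure k s = ∫⁻ t in s ∩ Ioo (-1) 1,
      ENNReal.ofReal ((1 + t) * (1 - t ^ 2) ^ (k - 1)) := by
  rw [intertwiningDensityMeasure, withDensity_apply _ hs, Measure.restrict_restrict hs]
  refine setLIntegral_congr ?_
  exact (Filter.EventuallyEq.refl _ s).inter Ioo_ae_eq_Icc.symm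

lemma intertwiningDensityMeasure_le {k δ : ℝ} (hk : 0 < k) (hδ : 0 ≤ δ) :
    intertwiningDensityMeasure k {t | 1 - t ≤ δ} ≤ ENNReal.ofReal (2 ^ k / k * δ ^ k) := by
  rw [intertwiningDensityMeasure_apply k (measurableSet_le (by fun_prop) (by fun_prop))]
  calc ∫⁻ t in {t | 1 - t ≤ δ} ∩ Ioo (-1) 1, ENNReal.ofReal ((1 + t) * (1 - t ^ 2) ^ (k - 1))
      ≤ ∫⁻ t in {t | 1 - t ≤ δ} ∩ Ioo (-1) 1,
          ENNReal.ofReal (2 ^ k) * ENNReal.ofReal ((1 - t) ^ (k - 1)) := by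
        refine setLIntegral_mono' ((measurableSet_le (by fun_prop) (by fun_prop)).inter
          measurableSet_Ioo) fun t ht => ?_
        have h1 : 0 < 1 + t := by linarith [ht.2.1]
        have h2 : 0 < 1 - t := by linarith [ht.2.2]
        rw [intertwining_density_eq ht.2.1 ht.2.2, ← ENNReal.ofReal_mul (by positivity)]
        refine ENNReal.ofReal_le_ofReal ?_
        gcongr
        linarith [ht.2.2]
    _ ≤ ∫⁻ t in Icc (1 - δ) 1, ENNReal.ofReal (2 ^ k) * ENNReal.ofReal ((1 - t) ^ (k - 1)) := by
        refine lintegral_mono_set fun t ht => ?_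
        have h : 1 - t ≤ δ := ht.1
        exact ⟨by linarith, ht.2.2.le⟩
    _ = ENNReal.ofReal (2 ^ k / k * δ ^ k) := by
        rw [← Measure.restrict_congr_set (Ioo_ae_eq_Icc (a := 1 - δ) (b := (1 : ℝ))),
          lintegral_const_mul' _ _ ENNReal.ofReal_ne_top, lintegral_one_sub_rpow hk hδ,
          ← ENNReal.ofReal_mul (by positivity)]
        congr 1; ring

/-- A crude bound of density times length `1`. Near `-1` only an upper bound of the order found near
`1` is needed. -/
lemma intertwiningDensityMeasure_le' {k δ : ℝ} (hk : 0 < k) (hδ : 0 ≤ δ) (hδ1 : δ ≤ 1) :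
    intertwiningDensityMeasure k {t | 1 + t ≤ δ} ≤ ENNReal.ofReal (2 ^ k * δ ^ k) := by
  rw [intertwiningDensityMeasure_apply k (measurableSet_le (by fun_prop) (by fun_prop))]
  calc ∫⁻ t in {t | 1 + t ≤ δ} ∩ Ioo (-1) 1, ENNReal.ofReal ((1 + t) * (1 - t ^ 2) ^ (k - 1))
      ≤ ∫⁻ t in {t | 1 + t ≤ δ} ∩ Ioo (-1) 1, ENNReal.ofReal (2 ^ k * δ ^ k) := by
        refine setLIntegral_mono' ((measurableSet_le (by fun_prop) (by fun_prop)).inter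
          measurableSet_Ioo) fun t ht => ?_
        have h1 : 0 < 1 + t := by linarith [ht.2.1]
        have h2 : 1 + t ≤ δ := ht.1
        rw [intertwining_density_eq ht.2.1 ht.2.2, mul_comm (2 ^ k : ℝ)]
        refine ENNReal.ofReal_le_ofReal ?_
        have h3 : (1 - t) ^ (k - 1) ≤ 2 ^ k :=
          (Real.rpow_le_rpow_of_exponent_le (by linarith) (by linarith)).trans
            (Real.rpow_le_rpow (by linarith) (by linarith) hk.le)
        have h4 : 0 ≤ (1 - t) ^ (k - 1) := Real.rpow_nonneg (by linarith) _
        gcongr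
    _ ≤ ∫⁻ t in Ioc (-1 : ℝ) 0, ENNReal.ofReal (2 ^ k * δ ^ k) := by
        refine lintegral_mono_set fun t ht => ?_
        have h : 1 + t ≤ δ := ht.1
        exact ⟨ht.2.1, by linarith⟩
    _ = _ := by simp

lemma le_intertwiningDensityMeasure {k δ : ℝ} (hk : 0 < k) (hδ : 0 ≤ δ) (hδ1 : δ ≤ 1) :
    ENNReal.ofReal (δ ^ k / k) ≤ intertwiningDensityMeasure k (Icc (1 - δ) 1) := by
  rw [intertwiningDensityMeasure_apply k measurableSet_Icc, ← lintegral_one_sub_rpow hk hδ]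
  calc ∫⁻ t in Ioo (1 - δ) 1, ENNReal.ofReal ((1 - t) ^ (k - 1))
      ≤ ∫⁻ t in Ioo (1 - δ) 1, ENNReal.ofReal ((1 + t) * (1 - t ^ 2) ^ (k - 1)) := by
        refine setLIntegral_mono' measurableSet_Ioo fun t ht => ?_
        rw [intertwining_density_eq (by linarith [ht.1]) ht.2]
        refine ENNReal.ofReal_le_ofReal (le_mul_of_one_le_left ?_ ?_)
        · exact Real.rpow_nonneg (by linarith [ht.2]) _
        · exact Real.one_le_rpow (by linarith [ht.1]) hk.le
    _ ≤ _ := by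
        refine lintegral_mono_set fun t ht => ?_
        exact ⟨⟨ht.1.le, ht.2.le⟩, by linarith [ht.1], ht.2⟩

lemma intertwiningDensityMeasure_univ_ne_top {k : ℝ} (hk : 0 < k) :
    intertwiningDensityMeasure k univ ≠ ∞ := by
  refine ne_top_of_le_ne_top (ENNReal.ofReal_ne_top (r := 2 ^ k / k * 2 ^ k)) ?_
  refine le_trans (le_of_eq ?_) (intertwiningDensityMeasure_le hk zero_le_two)
  rw [intertwiningDensityMeasure_apply k .univ,
    intertwiningDensityMeasure_apply k (measurableSet_le (by fun_prop) (by fun_prop))]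
  congr 2
  ext t
  simp only [univ_inter, mem_inter_iff, mem_ofPred_eq, mem_Ioo]
  constructor
  · intro h; exact ⟨by linarith [h.1], h⟩
  · exact fun h => h.2

lemma intertwiningDensityMeasure_univ_ne_zero {k : ℝ} (hk : 0 < k) :
    intertwiningDensityMeasure k univ ≠ 0 := by
  have h := le_intertwiningDensityMeasure hk zero_le_one le_rfl
  have h1 : 0 < ENNReal.ofReal (1 ^ k / k) := ENNReal.ofReal_pos.2 (by positivity)
  exact ((h1.trans_le h).trans_le (measure_mono (subset_univ _))).ne'

lemma intertwiningMeasure_zero : intertwiningMeasure 0 = Measure.dirac 1 := by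
  simp [intertwiningMeasure]

lemma intertwiningMeasure_of_pos {k : ℝ} (hk : 0 < k) (s : Set ℝ) :
    intertwiningMeasure k s =
      (intertwiningDensityMeasure k univ)⁻¹ * intertwiningDensityMeasure k s := by
  rw [intertwiningMeasure, if_neg hk.ne', Measure.smul_apply, smul_eq_mul]

lemma isProbabilityMeasure_intertwiningMeasure {k : ℝ} (hk : 0 ≤ k) :
    IsProbabilityMeasure (intertwiningMeasure k) := by
  rcases hk.eq_or_lt with rfl | hk
  · rw [intertwiningMeasure_zero]; infer_instance
  · refine ⟨?_⟩
    rw [intertwiningMeasure_of_pos hk]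
    exact ENNReal.inv_mul_cancel (intertwiningDensityMeasure_univ_ne_zero hk)
      (intertwiningDensityMeasure_univ_ne_top hk)

lemma intertwiningMeasure_compl_Icc {k : ℝ} (hk : 0 ≤ k) :
    intertwiningMeasure k (Icc (-1) 1)ᶜ = 0 := by
  rcases hk.eq_or_lt with rfl | hk
  · rw [intertwiningMeasure_zero, Measure.dirac_apply' _ measurableSet_Icc.compl]
    simp
  · rw [intertwiningMeasure_of_pos hk, intertwiningDensityMeasure_apply k measurableSet_Icc.compl]
    have : (Icc (-1 : ℝ) 1)ᶜ ∩ Ioo (-1) 1 = ∅ := by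
      ext t
      simp only [mem_inter_iff, mem_compl_iff, mem_empty_iff_false, iff_false, not_and]
      exact fun h h' => h (Ioo_subset_Icc_self h')
    rw [this]
    simp

/-- In use, `σ` is the sign of `x_i y_i`: the endpoint near which `t_i` must lie for the inner
product to be large. -/
lemma exists_intertwiningMeasure_le {k : ℝ} (hk : 0 ≤ k) :
    ∃ C : ℝ, 1 ≤ C ∧ ∀ σ δ : ℝ, (σ = 1 ∨ σ = -1) → 0 < δ →
      intertwiningMeasure k {t | 1 - σ * t ≤ δ} ≤ ENNReal.ofReal (C * δ ^ k) := by
  have := isProbabilityMeasure_intertwiningMeasure hk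
  rcases hk.eq_or_lt with rfl | hk
  · refine ⟨1, le_rfl, fun σ δ _ _ => ?_⟩
    simpa using prob_le_one
  set m := intertwiningDensityMeasure k univ with hm
  have hm0 : m⁻¹ ≠ ∞ := ENNReal.inv_ne_top.2 (intertwiningDensityMeasure_univ_ne_zero hk)
  set M := (m⁻¹).toReal with hM
  have hMm : m⁻¹ = ENNReal.ofReal M := (ENNReal.ofReal_toReal hm0).symm
  have hM0 : 0 ≤ M := ENNReal.toReal_nonneg
  refine ⟨1 + M * (2 ^ k / k) + M * 2 ^ k, ?_, fun σ δ hσ hδ => ?_⟩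
  · have : 0 ≤ M * (2 ^ k / k) := by positivity
    have : 0 ≤ M * 2 ^ k := by positivity
    linarith
  have hδk : 0 ≤ δ ^ k := by positivity
  have h1 : 0 ≤ M * (2 ^ k / k) * δ ^ k := by positivity
  have h2 : 0 ≤ M * 2 ^ k * δ ^ k := by positivity
  rcases hσ with rfl | rfl
  · rw [intertwiningMeasure_of_pos hk, ← hm, hMm]
    simp only [one_mul]
    calc ENNReal.ofReal M * intertwiningDensityMeasure k {t | 1 - t ≤ δ}
        ≤ ENNReal.ofReal M * ENNReal.ofReal (2 ^ k / k * δ ^ k) := by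
          gcongr; exact intertwiningDensityMeasure_le hk hδ.le
      _ ≤ _ := by
          rw [← ENNReal.ofReal_mul hM0]
          refine ENNReal.ofReal_le_ofReal ?_
          nlinarith
  · rcases le_or_gt δ 1 with hδ1 | hδ1
    · rw [intertwiningMeasure_of_pos hk, ← hm, hMm]
      simp only [neg_mul, one_mul, sub_neg_eq_add]
      calc ENNReal.ofReal M * intertwiningDensityMeasure k {t | 1 + t ≤ δ}
          ≤ ENNReal.ofReal M * ENNReal.ofReal (2 ^ k * δ ^ k) := by
            gcongr; exact intertwiningDensityMeasure_le' hk hδ.le hδ1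
        _ ≤ _ := by
            rw [← ENNReal.ofReal_mul hM0]
            refine ENNReal.ofReal_le_ofReal ?_
            nlinarith
    · refine prob_le_one.trans ?_
      rw [← ENNReal.ofReal_one]
      refine ENNReal.ofReal_le_ofReal ?_
      have := Real.one_le_rpow hδ1.le hk.le
      nlinarith

lemma exists_le_intertwiningMeasure {k : ℝ} (hk : 0 ≤ k) :
    ∃ c : ℝ, 0 < c ∧ ∀ δ : ℝ, 0 < δ → δ ≤ 1 →
      ENNReal.ofReal (c * δ ^ k) ≤ intertwiningMeasure k (Icc (1 - δ) 1) := by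
  rcases hk.eq_or_lt with rfl | hk
  · refine ⟨1, one_pos, fun δ hδ _ => ?_⟩
    rw [intertwiningMeasure_zero, Measure.dirac_apply' _ measurableSet_Icc,
      indicator_of_mem (show (1 : ℝ) ∈ Icc (1 - δ) 1 from ⟨by linarith, le_rfl⟩)]
    simp
  set m := intertwiningDensityMeasure k univ with hm
  have hm0 : m⁻¹ ≠ ∞ := ENNReal.inv_ne_top.2 (intertwiningDensityMeasure_univ_ne_zero hk)
  have hm1 : m⁻¹ ≠ 0 := ENNReal.inv_ne_zero.2 (intertwiningDensityMeasure_univ_ne_top hk)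
  have hM0 : 0 < (m⁻¹).toReal := ENNReal.toReal_pos hm1 hm0
  refine ⟨(m⁻¹).toReal / k, by positivity, fun δ hδ hδ1 => ?_⟩
  rw [intertwiningMeasure_of_pos hk, ← hm]
  calc ENNReal.ofReal ((m⁻¹).toReal / k * δ ^ k)
      = ENNReal.ofReal (m⁻¹).toReal * ENNReal.ofReal (δ ^ k / k) := by
        rw [← ENNReal.ofReal_mul hM0.le]; congr 1; ring
    _ ≤ _ := by
        rw [ENNReal.ofReal_toReal hm0]
        gcongr
        exact le_intertwiningDensityMeasure hk hδ.le hδ1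

end IntertwiningMeasure

/-! ### Two-sided kernel estimates and pointwise domination of the maximal function. -/

namespace FoldedSphere

variable {d : ℕ}

lemma sum_sq_coord (x : FoldedSphere d) : ∑ i, x.1 i ^ 2 = 1 := by
  have h := EuclideanSpace.real_norm_sq_eq x.1
  rw [norm_eq_one] at h
  rw [← h]; norm_num

lemma isClosed_solidCap (x : EuclideanSpace ℝ (Fin (d + 1))) (θ : ℝ) :
    IsClosed (solidCap x θ) := by
  simp only [solidCap, ofPred_and]
  exact (isClosed_le (by fun_prop) (by fun_prop)).inter (isClosed_le (by fun_prop) (by fun_prop))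

/-- The factors `t` which move `y` into the solid cap around `x`. -/
def capFactors (x y : FoldedSphere d) (θ : ℝ) : Set (Fin (d + 1) → ℝ) :=
  {t | (WithLp.toLp 2 fun i => y.1 i * t i) ∈ solidCap x.1 θ}

lemma intertwiningOp_indicator (κ : Fin (d + 1) → ℝ) (x y : FoldedSphere d) (θ : ℝ) :
    intertwiningOp κ ((solidCap x.1 θ).indicator 1) y.1 =
      Measure.pi (fun i => intertwiningMeasure (κ i)) (capFactors x y θ) := by
  have hm : MeasurableSet (capFactors x y θ) :=
    (isClosed_solidCap x.1 θ).measurableSet.preimage (by fun_prop)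
  rw [← lintegral_indicator_one hm]
  rfl

lemma mem_capFactors_iff {x y : FoldedSphere d} {θ : ℝ} {t : Fin (d + 1) → ℝ} :
    t ∈ capFactors x y θ ↔ ∑ i, (y.1 i * t i) ^ 2 ≤ 1 ∧
      Real.cos θ ≤ ∑ i, x.1 i * (y.1 i * t i) := by
  have e1 : inner ℝ x.1 (WithLp.toLp 2 fun i => y.1 i * t i) = ∑ i, x.1 i * (y.1 i * t i) := by
    rw [PiLp.inner_apply]
    exact Finset.sum_congr rfl fun i _ => by simp [mul_comm]
  have e2 : ‖(WithLp.toLp 2 fun i => y.1 i * t i : EuclideanSpace ℝ (Fin (d + 1)))‖ ≤ 1 ↔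
      ∑ i, (y.1 i * t i) ^ 2 ≤ 1 := by
    rw [← sq_le_one_iff₀ (norm_nonneg _), EuclideanSpace.real_norm_sq_eq]
  change (_ ≤ _ ∧ _ ≤ _) ↔ _
  rw [e1, e2]

lemma sum_abs_mul_abs (x y : FoldedSphere d) :
    ∑ i, (|x.1 i| - |y.1 i|) ^ 2 = 2 - 2 * ∑ i, |x.1 i * y.1 i| := by
  have e : ∀ i, (|x.1 i| - |y.1 i|) ^ 2 = x.1 i ^ 2 + y.1 i ^ 2 - 2 * |x.1 i * y.1 i| := by
    intro i
    rw [abs_mul, sub_sq, sq_abs, sq_abs]; ring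
  simp only [e, Finset.sum_sub_distrib, Finset.sum_add_distrib, ← Finset.mul_sum, sum_sq_coord]
  norm_num

lemma sum_abs_mul_le_one (x y : FoldedSphere d) : ∑ i, |x.1 i * y.1 i| ≤ 1 := by
  have h : 0 ≤ ∑ i, (|x.1 i| - |y.1 i|) ^ 2 := Finset.sum_nonneg fun i _ => sq_nonneg _
  rw [sum_abs_mul_abs] at h
  linarith

/-- With `σ_i` the sign of `x_i y_i`, the terms `|x_i y_i| (1 - σ_i t_i)` are nonnegative and sum to
`∑ |x_i y_i| - ∑ x_i y_i t_i ≤ 1 - cos θ ≤ θ²/2`, which bounds each of them. Also `∑ |x_i y_i| ≥ cos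
θ`, which bounds the distance between the folded points. -/
lemma capFactors_bounds {x y : FoldedSphere d} {θ : ℝ} {t : Fin (d + 1) → ℝ}
    (ht : t ∈ capFactors x y θ) (hI : ∀ i, t i ∈ Icc (-1 : ℝ) 1) :
    (∀ i, abs (|y.1 i| - |x.1 i|) ≤ |θ|) ∧
      ∀ i, |x.1 i * y.1 i| * (1 - (if 0 ≤ x.1 i * y.1 i then 1 else -1) * t i) ≤ θ ^ 2 / 2 := by
  obtain ⟨-, hcos⟩ := mem_capFactors_iff.1 ht
  have hcos' := Real.one_sub_sq_div_two_le_cos (x := θ)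
  have e : ∀ i, |x.1 i * y.1 i| * (1 - (if 0 ≤ x.1 i * y.1 i then 1 else -1) * t i) =
      |x.1 i * y.1 i| - x.1 i * (y.1 i * t i) := by
    intro i
    split_ifs with h
    · rw [abs_of_nonneg h]; ring
    · rw [abs_of_neg (not_le.1 h)]; ring
  have hnn : ∀ i, 0 ≤ |x.1 i * y.1 i| * (1 - (if 0 ≤ x.1 i * y.1 i then 1 else -1) * t i) := by
    intro i
    refine mul_nonneg (abs_nonneg _) ?_
    have := hI i
    split_ifs <;> linarith [this.1, this.2]
  have hsum : ∑ i, |x.1 i * y.1 i| * (1 - (if 0 ≤ x.1 i * y.1 i then 1 else -1) * t i) =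
      ∑ i, |x.1 i * y.1 i| - ∑ i, x.1 i * (y.1 i * t i) := by
    simp only [e, Finset.sum_sub_distrib]
  have hle := sum_abs_mul_le_one x y
  constructor
  · intro i
    rw [abs_sub_comm]
    refine sq_le_sq.1 ?_
    have h0 : 0 ≤ ∑ i, |x.1 i * y.1 i| - ∑ i, x.1 i * (y.1 i * t i) := by
      rw [← hsum]; exact Finset.sum_nonneg fun i _ => hnn i
    calc (|x.1 i| - |y.1 i|) ^ 2 ≤ ∑ i, (|x.1 i| - |y.1 i|) ^ 2 :=
          Finset.single_le_sum (f := fun i => (|x.1 i| - |y.1 i|) ^ 2)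
            (fun i _ => sq_nonneg _) (Finset.mem_univ i)
      _ ≤ θ ^ 2 := by rw [sum_abs_mul_abs]; linarith
  · intro i
    refine (Finset.single_le_sum (f := fun i => |x.1 i * y.1 i| *
      (1 - (if 0 ≤ x.1 i * y.1 i then 1 else -1) * t i)) (fun i _ => hnn i)
      (Finset.mem_univ i)).trans ?_
    rw [hsum]; linarith

/-- The size of the kernel `V_κ[χ_{B(x,θ)}]`. -/
def kernelSize (κ : Fin (d + 1) → ℝ) (x : FoldedSphere d) (θ : ℝ) : ℝ :=
  ∏ i, (θ / (|x.1 i| + θ)) ^ (2 * κ i)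

lemma kernelSize_pos (κ : Fin (d + 1) → ℝ) (x : FoldedSphere d) {θ : ℝ} (hθ : 0 < θ) :
    0 < kernelSize κ x θ :=
  Finset.prod_pos fun i _ => by positivity

lemma ae_mem_Icc {κ : Fin (d + 1) → ℝ} (hκ : ∀ i, 0 ≤ κ i) :
    ∀ᵐ t ∂(Measure.pi fun i => intertwiningMeasure (κ i)), ∀ i, t i ∈ Icc (-1 : ℝ) 1 := by
  have := fun i => isProbabilityMeasure_intertwiningMeasure (hκ i)
  rw [ae_all_iff]
  intro i
  have h : ∀ᵐ s ∂(intertwiningMeasure (κ i)), s ∈ Icc (-1 : ℝ) 1 :=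
    intertwiningMeasure_compl_Icc (hκ i)
  exact Measure.tendsto_eval_ae_ae.eventually h

lemma intertwiningOp_eq_zero {κ : Fin (d + 1) → ℝ} (hκ : ∀ i, 0 ≤ κ i) {x y : FoldedSphere d}
    {θ : ℝ} (hθ : 0 < θ) (hy : y ∉ ball x (2 * θ)) :
    intertwiningOp κ ((solidCap x.1 θ).indicator 1) y.1 = 0 := by
  rw [intertwiningOp_indicator, measure_eq_zero_iff_ae_notMem]
  filter_upwards [ae_mem_Icc hκ] with t ht hmem
  refine hy ((mem_ball_iff (by positivity)).2 fun i => ?_)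
  have := (capFactors_bounds hmem ht).1 i
  rw [abs_of_pos hθ] at this
  linarith

/-- The cap condition implies separate conditions on the `t_i`, so the product measure is bounded by
a product of endpoint masses. -/
lemma intertwiningOp_le {κ : Fin (d + 1) → ℝ} (hκ : ∀ i, 0 ≤ κ i) :
    ∃ C : ℝ, 0 < C ∧ ∀ (x y : FoldedSphere d) (θ : ℝ), 0 < θ → y ∈ ball x (2 * θ) →
      intertwiningOp κ ((solidCap x.1 θ).indicator 1) y.1 ≤
        ENNReal.ofReal (C * kernelSize κ x θ) := by
  have hprob := fun i => isProbabilityMeasure_intertwiningMeasure (hκ i)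
  choose C hC1 hC using fun i => exists_intertwiningMeasure_le (hκ i)
  have hC0 : ∀ i, 0 < C i := fun i => one_pos.trans_le (hC1 i)
  refine ⟨∏ i, C i * 5 ^ (2 * κ i), Finset.prod_pos fun i _ => mul_pos (hC0 i) (by positivity),
    fun x y θ hθ hy => ?_⟩
  set E : Fin (d + 1) → Set ℝ := fun i =>
    {t | |x.1 i * y.1 i| * (1 - (if 0 ≤ x.1 i * y.1 i then 1 else -1) * t) ≤ θ ^ 2 / 2} with hE
  have hEle : ∀ i, intertwiningMeasure (κ i) (E i) ≤
      ENNReal.ofReal (C i * 5 ^ (2 * κ i) * (θ / (|x.1 i| + θ)) ^ (2 * κ i)) := by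
    intro i
    have hx0 := abs_nonneg (x.1 i)
    have hk : 0 ≤ 2 * κ i := by linarith [hκ i]
    rw [mul_assoc, ← Real.mul_rpow (by norm_num) (by positivity)]
    -- Below `4θ` the claimed factor is at least `1`. Above it, `|y_i| ≥ |x_i|/2`, so `t_i` lies
    -- within `(θ/|x_i|)²` of an endpoint.
    rcases lt_or_ge (|x.1 i|) (4 * θ) with h4 | h4
    · refine prob_le_one.trans ?_
      rw [← ENNReal.ofReal_one]
      refine ENNReal.ofReal_le_ofReal ?_
      refine one_le_mul_of_one_le_of_one_le (hC1 i) (Real.one_le_rpow ?_ hk)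
      rw [mul_div_assoc', one_le_div (by positivity)]
      linarith
    · have hyi := (mem_ball_iff (by positivity)).1 hy i
      obtain ⟨h1, h2⟩ := abs_lt.1 hyi
      have hxpos : 0 < |x.1 i| := by linarith
      have hxy : |x.1 i| ^ 2 / 2 ≤ |x.1 i * y.1 i| := by
        rw [abs_mul]; nlinarith
      calc intertwiningMeasure (κ i) (E i)
          ≤ intertwiningMeasure (κ i) {t | 1 - (if 0 ≤ x.1 i * y.1 i then 1 else -1) * t ≤
              (θ / |x.1 i|) ^ 2} := by
            refine measure_mono fun t ht => ?_
            have ht' : |x.1 i * y.1 i| * (1 - (if 0 ≤ x.1 i * y.1 i then 1 else -1) * t) ≤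
              θ ^ 2 / 2 := ht
            change 1 - (if 0 ≤ x.1 i * y.1 i then 1 else -1) * t ≤ (θ / |x.1 i|) ^ 2
            rw [div_pow, le_div_iff₀ (by positivity)]
            by_contra! hcon
            have hpos : 0 < 1 - (if 0 ≤ x.1 i * y.1 i then 1 else -1) * t := by
              by_contra! hneg
              nlinarith [sq_nonneg θ, sq_nonneg (|x.1 i|)]
            nlinarith
        _ ≤ ENNReal.ofReal (C i * ((θ / |x.1 i|) ^ 2) ^ κ i) :=
            hC i _ _ (by split_ifs <;> simp) (by positivity)
        _ ≤ _ := by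
            refine ENNReal.ofReal_le_ofReal (mul_le_mul_of_nonneg_left ?_ (hC0 i).le)
            rw [← Real.rpow_natCast, ← Real.rpow_mul (by positivity)]
            refine Real.rpow_le_rpow (by positivity) ?_ hk
            rw [mul_div_assoc', div_le_div_iff₀ hxpos (by positivity)]
            nlinarith
  rw [intertwiningOp_indicator]
  calc Measure.pi (fun i => intertwiningMeasure (κ i)) (capFactors x y θ)
      ≤ Measure.pi (fun i => intertwiningMeasure (κ i)) (univ.pi E) := by
        refine measure_mono_ae ?_
        filter_upwards [ae_mem_Icc hκ] with t ht hmem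
        exact fun i _ => (capFactors_bounds hmem ht).2 i
    _ = ∏ i, intertwiningMeasure (κ i) (E i) := Measure.pi_pi _ _
    _ ≤ ∏ i, ENNReal.ofReal (C i * 5 ^ (2 * κ i) * (θ / (|x.1 i| + θ)) ^ (2 * κ i)) :=
        Finset.prod_le_prod' fun i _ => hEle i
    _ = _ := by
        rw [← ENNReal.ofReal_prod_of_nonneg fun i _ => by have := hC0 i; positivity,
          Finset.prod_mul_distrib, kernelSize]

/-- If `y` is close to `x` in the same orthant, `⟨x, y⟩` is nearly `1` and all `t_i` close to `1`
keep the point in the cap. A product of intervals therefore lies in `capFactors`. -/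
lemma le_intertwiningOp {κ : Fin (d + 1) → ℝ} (hκ : ∀ i, 0 ≤ κ i) :
    ∃ c : ℝ, 0 < c ∧ ∀ (x y : FoldedSphere d) (θ : ℝ), 0 < θ → θ ≤ Real.pi →
      y ∈ signedBall x (θ / (4 * (d + 1))) →
      ENNReal.ofReal (c * kernelSize κ x θ) ≤
        intertwiningOp κ ((solidCap x.1 θ).indicator 1) y.1 := by
  have hprob := fun i => isProbabilityMeasure_intertwiningMeasure (hκ i)
  choose c hc0 hc using fun i => exists_le_intertwiningMeasure (hκ i)
  set n : ℝ := d + 1 with hn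
  have hn1 : 1 ≤ n := by linarith [Nat.cast_nonneg (α := ℝ) d]
  have hn0 : 0 < n := by linarith
  refine ⟨∏ i, c i * ((10 * n)⁻¹) ^ κ i, Finset.prod_pos fun i _ => mul_pos (hc0 i) (by positivity),
    fun x y θ hθ hθπ hy => ?_⟩
  -- The loss in coordinate `i` is at most `(|x_i|+θ)² δ_i = θ²/(10n)`, while `δ_i^(κ_i)` reproduces
  -- the factor of `kernelSize`.
  set δ : Fin (d + 1) → ℝ := fun i => (10 * n)⁻¹ * (θ / (|x.1 i| + θ)) ^ 2 with hδ
  have hδ0 : ∀ i, 0 < δ i := fun i => by positivity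
  have hδ1 : ∀ i, δ i ≤ 1 := by
    intro i
    refine mul_le_one₀ (inv_le_one_of_one_le₀ (by linarith)) (by positivity) ?_
    refine pow_le_one₀ (by positivity) ?_
    rw [div_le_one (by positivity)]
    linarith [abs_nonneg (x.1 i)]
  have hsub : univ.pi (fun i => Icc (1 - δ i) 1) ⊆ capFactors x y θ := by
    intro t ht
    have hti : ∀ i, 1 - δ i ≤ t i ∧ t i ≤ 1 := fun i => ht i (mem_univ i)
    rw [mem_capFactors_iff]
    constructor
    · refine (Finset.sum_le_sum fun i _ => ?_).trans (sum_sq_coord y).le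
      rw [mul_pow]
      refine mul_le_of_le_one_right (sq_nonneg _) ?_
      have := hδ1 i
      exact pow_le_one₀ (by linarith [(hti i).1]) (hti i).2
    · have hterm : ∀ i, x.1 i * y.1 i - x.1 i * (y.1 i * t i) ≤ (10 * n)⁻¹ * θ ^ 2 := by
        intro i
        obtain ⟨h1, h2⟩ := hy i
        have hx0 := abs_nonneg (x.1 i)
        have hyle : |y.1 i| ≤ |x.1 i| + θ := by
          have h3 : θ / (4 * n) ≤ θ := div_le_self hθ.le (by linarith)
          linarith [(abs_lt.1 h1).2]
        calc x.1 i * y.1 i - x.1 i * (y.1 i * t i) = (x.1 i * y.1 i) * (1 - t i) := by ring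
          _ ≤ (x.1 i * y.1 i) * δ i := by
              gcongr; linarith [(hti i).1]
          _ ≤ ((|x.1 i| + θ) * (|x.1 i| + θ)) * δ i := by
              refine mul_le_mul_of_nonneg_right ?_ (hδ0 i).le
              rw [← abs_of_nonneg h2, abs_mul]
              gcongr
              linarith
          _ = (10 * n)⁻¹ * θ ^ 2 := by rw [hδ]; field_simp
      have hdist : ∑ i, (|x.1 i| - |y.1 i|) ^ 2 ≤ n * (θ / (4 * n)) ^ 2 := by
        calc ∑ i, (|x.1 i| - |y.1 i|) ^ 2 ≤ ∑ i : Fin (d + 1), (θ / (4 * n)) ^ 2 := by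
              refine Finset.sum_le_sum fun i _ => ?_
              rw [← sq_abs, abs_sub_comm]
              gcongr
              exact (hy i).1.le
          _ = _ := by simp [hn]
      have habs : ∑ i, |x.1 i * y.1 i| = ∑ i, x.1 i * y.1 i :=
        Finset.sum_congr rfl fun i _ => abs_of_nonneg (hy i).2
      rw [sum_abs_mul_abs, habs] at hdist
      have hsum : ∑ i, x.1 i * y.1 i - ∑ i, x.1 i * (y.1 i * t i) ≤ θ ^ 2 / 10 := by
        rw [← Finset.sum_sub_distrib]
        calc ∑ i, (x.1 i * y.1 i - x.1 i * (y.1 i * t i)) ≤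
              ∑ i : Fin (d + 1), (10 * n)⁻¹ * θ ^ 2 := Finset.sum_le_sum fun i _ => hterm i
          _ = n * ((10 * n)⁻¹ * θ ^ 2) := by simp [hn]
          _ = θ ^ 2 / 10 := by field_simp
      have hn16 : n * (θ / (4 * n)) ^ 2 ≤ θ ^ 2 / 16 := by
        have : n * (θ / (4 * n)) ^ 2 = θ ^ 2 / 16 / n := by field_simp; norm_num
        rw [this]
        exact div_le_self (by positivity) hn1
      -- For `θ ≤ π` one has `cos θ ≤ 1 - 2θ²/π² ≤ 1 - θ²/5`, while the total loss is at most `θ²/32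
      -- + θ²/10`.
      have hcos := Real.cos_le_one_sub_mul_cos_sq (x := θ) (by rw [abs_of_pos hθ]; exact hθπ)
      have hpi : 1 / 5 ≤ 2 / Real.pi ^ 2 := by
        rw [div_le_div_iff₀ (by norm_num) (by positivity)]
        nlinarith [Real.pi_lt_d2, Real.pi_pos]
      nlinarith [mul_le_mul_of_nonneg_right hpi (sq_nonneg θ)]
  rw [intertwiningOp_indicator]
  calc ENNReal.ofReal ((∏ i, c i * ((10 * n)⁻¹) ^ κ i) * kernelSize κ x θ)
      = ∏ i, ENNReal.ofReal (c i * δ i ^ κ i) := by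
        rw [← ENNReal.ofReal_prod_of_nonneg fun i _ => by
          have := (hc0 i).le; have := (hδ0 i).le; positivity, kernelSize, ← Finset.prod_mul_distrib]
        congr 1
        refine Finset.prod_congr rfl fun i _ => ?_
        rw [hδ]; dsimp only
        rw [Real.mul_rpow (by positivity) (by positivity), ← Real.rpow_natCast (θ / _),
          ← Real.rpow_mul (by positivity), mul_assoc]
        norm_num
    _ ≤ ∏ i, intertwiningMeasure (κ i) (Icc (1 - δ i) 1) :=
        Finset.prod_le_prod' fun i _ => hc i (δ i) (hδ0 i) (hδ1 i)
    _ = Measure.pi (fun i => intertwiningMeasure (κ i)) (univ.pi fun i => Icc (1 - δ i) 1) :=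
        (Measure.pi_pi _ _).symm
    _ ≤ _ := measure_mono hsub

/-- The maximal function of the intertwining operator is controlled by the Hardy–Littlewood maximal
function of the folded sphere. -/
theorem intertwiningMaximal_le {κ : Fin (d + 1) → ℝ} (hκ : ∀ i, 0 ≤ κ i) {𝕜 : Type*} [RCLike 𝕜] :
    ∃ K : ℝ≥0, ∀ (f : UnitSphere d → 𝕜) (x : FoldedSphere d),
      intertwiningMaximal κ f x ≤ K * maximalFn (measure κ) (fun y => ‖f y‖ₑ) x := by
  have hκ0 : ∀ i, -(1 / 2) < κ i := fun i => by linarith [hκ i]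
  obtain ⟨C, hC0, hC⟩ := intertwiningOp_le (d := d) hκ
  obtain ⟨c, hc0, hc⟩ := le_intertwiningOp (d := d) hκ
  obtain ⟨D, hD⟩ := exists_isDoublingOn hκ0
  set n : ℝ := d + 1 with hn
  have hn1 : 1 ≤ n := by linarith [Nat.cast_nonneg (α := ℝ) d]
  -- `8n` is the ratio of `2θ`, the radius supporting the kernel, to `θ/(4n)`, the radius of its
  -- lower bound.
  obtain ⟨K, hK⟩ := measure_ball_mul_le (d := d) hκ0 (l := 8 * n) (by linarith)
  refine ⟨(C / c).toNNReal * K, fun f x => iSup₂_le fun θ hθ => ?_⟩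
  obtain ⟨hθ0, hθπ⟩ := hθ
  have hΦ := kernelSize_pos κ x hθ0
  set Φ := kernelSize κ x θ with hΦdef
  set op : FoldedSphere d → ℝ≥0∞ := fun y =>
    intertwiningOp κ ((solidCap x.1 θ).indicator 1) y.1 with hop
  set M := maximalFn (measure κ) (fun y : FoldedSphere d => ‖f y‖ₑ) x with hM
  set S := signedBall x (θ / (4 * n)) with hS
  have hSm : MeasurableSet S :=
    show MeasurableSet {y : UnitSphere d | y.1 ∈ signedNearSet x (θ / (4 * n))} from
      measurable_subtype_coe (measurableSet_signedNearSet x _)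
  change (∫⁻ y : FoldedSphere d, ‖f y‖ₑ * op y ∂(measure κ)) / ∫⁻ y, op y ∂(measure κ) ≤ _
  refine ENNReal.div_le_of_le_mul ?_
  have hnum : ∫⁻ y : FoldedSphere d, ‖f y‖ₑ * op y ∂(measure κ) ≤
      ENNReal.ofReal (C * Φ) * ∫⁻ y in ball x (2 * θ), ‖f y‖ₑ ∂(measure κ) := by
    rw [← lintegral_const_mul' _ _ ENNReal.ofReal_ne_top, ← lintegral_indicator measurableSet_ball]
    refine lintegral_mono fun y => ?_
    by_cases hy : y ∈ ball x (2 * θ)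
    · rw [indicator_of_mem hy, mul_comm]
      gcongr
      exact hC x y θ hθ0 hy
    · have : op y = 0 := intertwiningOp_eq_zero hκ hθ0 hy
      dsimp only
      rw [this, mul_zero]
      exact zero_le
  have hden : ENNReal.ofReal (c * Φ) * measure κ S ≤ ∫⁻ y, op y ∂(measure κ) := by
    rw [← setLIntegral_const]
    exact (setLIntegral_mono' hSm fun y hy => hc x y θ hθ0 hθπ hy).trans
      (setLIntegral_le_lintegral _ _)
  have h2θ : 0 < 2 * θ := by positivity
  have havg : ∫⁻ y in ball x (2 * θ), ‖f y‖ₑ ∂(measure κ) ≤ M * (K * measure κ S) := by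
    have h1 := hK x (θ / (4 * n)) (by positivity) (by
      have : 8 * n * (θ / (4 * n)) = 2 * θ := by field_simp; norm_num
      rw [this]; linarith [Real.pi_lt_d2])
    have h2 : 8 * n * (θ / (4 * n)) = 2 * θ := by field_simp; norm_num
    rw [h2] at h1
    refine le_trans ?_ (mul_le_mul_right h1 _)
    refine (ENNReal.div_le_iff_le_mul (Or.inl (hD.ball_pos x _ h2θ).ne')
      (Or.inl (hD.ball_lt_top x _).ne)).1 ?_
    exact le_maximalFn (mem_ball_self h2θ)
  calc ∫⁻ y : FoldedSphere d, ‖f y‖ₑ * op y ∂(measure κ)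
      ≤ ENNReal.ofReal (C * Φ) * (M * (K * measure κ S)) := hnum.trans (by gcongr)
    _ = (((C / c).toNNReal * K : ℝ≥0) : ℝ≥0∞) * M * (ENNReal.ofReal (c * Φ) * measure κ S) := by
        have : ENNReal.ofReal (C * Φ) = ENNReal.ofReal (C / c) * ENNReal.ofReal (c * Φ) := by
          rw [← ENNReal.ofReal_mul (by positivity)]; congr 1; field_simp
        rw [this, ENNReal.coe_mul, ENNReal.ofReal]
        ring
    _ ≤ _ := by gcongr

end FoldedSphere

end

/-! ### The vector-valued inequality for the intertwining maximal function. -/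

theorem mainTheorem7 {𝕜 : Type*} [RCLike 𝕜] (d : ℕ) (κ τ : Fin (d + 1) → ℝ) (p : ℝ)
    (hκ : ∀ i, 0 ≤ κ i) (hp : 1 < p)
    (hτ : ∀ i, -(1 / 2) < τ i ∧ τ i < p * κ i + (p - 1) / 2) :
    ∃ c : ℝ≥0, ∀ f : ℕ → UnitSphere d → 𝕜,
      (∀ j, AEStronglyMeasurable (f j) (surfaceMeasure d)) →
      weightedNorm τ p (fun x => (∑' j, intertwiningMaximal κ (f j) x ^ 2) ^ (1 / 2 : ℝ)) ≤
        c * weightedNorm τ p (fun x => (∑' j, ‖f j x‖ₑ ^ 2) ^ (1 / 2 : ℝ)) := by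
  have hp0 : 0 < p := by linarith
  obtain ⟨K, hK⟩ := FoldedSphere.intertwiningMaximal_le (d := d) hκ (𝕜 := 𝕜)
  obtain ⟨C, hC⟩ := FoldedSphere.maximalFn_vector_valued (d := d) hp hκ hτ
  refine ⟨(K ^ p * C) ^ (1 / p), fun f hf => ?_⟩
  have hfm : ∀ j, AEMeasurable (fun y : FoldedSphere d => ‖f j y‖ₑ) (FoldedSphere.surface d) :=
    fun j => (hf j).enorm
  -- Measurable representatives of `‖f_j‖`; surface-null sets are null for `h_κ² dω` and `h_τ² dω`,
  -- so neither the dominating maximal functions nor the right side change.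
  set g : ℕ → FoldedSphere d → ℝ≥0∞ := fun j => (hfm j).mk _ with hg
  have hgm : ∀ j, Measurable (g j) := fun j => (hfm j).measurable_mk
  have hfg : ∀ j, (fun y : FoldedSphere d => ‖f j y‖ₑ) =ᵐ[FoldedSphere.surface d] g j :=
    fun j => (hfm j).ae_eq_mk
  have hMfg : ∀ j (x : FoldedSphere d), intertwiningMaximal κ (f j) x ≤
      K * maximalFn (FoldedSphere.measure κ) (g j) x := fun j x =>
    (hK (f j) x).trans (mul_le_mul_right (maximalFn_mono_ae
      ((FoldedSphere.measure_absolutelyContinuous κ).ae_le ((hfg j).mono fun y hy => hy.le)) x) _)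
  have hexp : ∀ a : ℝ≥0∞, (a ^ (1 / 2 : ℝ)) ^ p = a ^ (p / 2) := fun a => by
    rw [← ENNReal.rpow_mul]; congr 1; ring
  have hleft : ∫⁻ x, ((∑' j, intertwiningMaximal κ (f j) x ^ 2) ^ (1 / 2 : ℝ)) ^ p
      ∂(weightedMeasure τ) ≤ (K ^ p * C : ℝ≥0) *
        ∫⁻ x, ((∑' j, ‖f j x‖ₑ ^ 2) ^ (1 / 2 : ℝ)) ^ p ∂(weightedMeasure τ) := by
    simp only [hexp]
    calc ∫⁻ x, (∑' j, intertwiningMaximal κ (f j) x ^ 2) ^ (p / 2) ∂(weightedMeasure τ)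
        ≤ ∫⁻ x, (K : ℝ≥0∞) ^ p * (∑' j, maximalFn (FoldedSphere.measure κ) (g j) x ^ (2 : ℝ)) ^
            (p / 2) ∂(FoldedSphere.measure τ) := by
          refine lintegral_mono fun x => ?_
          have h1 : ∑' j, intertwiningMaximal κ (f j) x ^ 2 ≤ (K : ℝ≥0∞) ^ (2 : ℝ) *
              ∑' j, maximalFn (FoldedSphere.measure κ) (g j) x ^ (2 : ℝ) := by
            rw [← ENNReal.tsum_mul_left]
            refine ENNReal.tsum_le_tsum fun j => ?_
            rw [← ENNReal.mul_rpow_of_nonneg _ _ zero_le_two, ENNReal.rpow_two]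
            gcongr
            exact hMfg j x
          refine (ENNReal.rpow_le_rpow h1 (by positivity)).trans (le_of_eq ?_)
          rw [ENNReal.mul_rpow_of_nonneg _ _ (by positivity), ← ENNReal.rpow_mul]
          congr 2; ring
      _ = (K : ℝ≥0∞) ^ p * ∫⁻ x, (∑' j, maximalFn (FoldedSphere.measure κ) (g j) x ^ (2 : ℝ)) ^
            (p / 2) ∂(FoldedSphere.measure τ) :=
          lintegral_const_mul' _ _ (by finiteness)
      _ ≤ (K : ℝ≥0∞) ^ p * (C * ∫⁻ x, (∑' j, g j x ^ (2 : ℝ)) ^ (p / 2)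
            ∂(FoldedSphere.measure τ)) := by
          gcongr
          exact hC g hgm
      _ = (K : ℝ≥0∞) ^ p * (C * ∫⁻ x : FoldedSphere d, (∑' j, ‖f j x‖ₑ ^ 2) ^ (p / 2)
            ∂(FoldedSphere.measure τ)) := by
          congr 2
          refine lintegral_congr_ae ((FoldedSphere.measure_absolutelyContinuous τ).ae_le ?_)
          filter_upwards [ae_all_iff.2 hfg] with x hx
          simp only [← hx, ENNReal.rpow_two]
      _ = _ := by
          rw [ENNReal.coe_mul, ENNReal.coe_rpow_of_nonneg _ hp0.le, mul_assoc]
          rfl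
  rw [weightedNorm, weightedNorm]
  refine (ENNReal.rpow_le_rpow hleft (by positivity)).trans (le_of_eq ?_)
  rw [ENNReal.mul_rpow_of_nonneg _ _ (by positivity), ENNReal.coe_rpow_of_nonneg _ (by positivity)]
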